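/- Let $\Gamma$ be a group that is virtually-(torsion-free solvable), that is, $\Gamma$ has a finite-index subgroup which is torsion-free and solvable, and suppose that $\Gamma$ has finite Hirsch rank (for one, equivalently every, solvable subgroup $S$ of finite index, the sum over $n\ge 0$ of the torsion-free ranks $\dim_{\mathbb Q}\bigl(S^{(n)}/S^{(n+1)}\otimes\mathbb Q\bigr)$ of the derived factors is finite). Let $H\le\Gamma$ be a finite subgroup, and let $\mathcal F_H$ be the poset, ordered by inclusion, of all finite subgroups $K\le\Gamma$ with $H<K$ (proper containment). Suppose that there is a finite subgroup $T$ of $\Gamma$ with $H<T$ and $|C_\Gamma(H):C_\Gamma(T)|<\infty$. Then for every such $T$ and every $L\in\mathcal F_H$ the subgroup $\langle T,L\rangle$ is finite, and the geometric realization $|\mathcal F_H|$ of the poset $\mathcal F_H$ is contractible. -/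

import Mathlib

universe u

/-- `Γ` is virtually-(torsion-free solvable): some subgroup of finite index is solvable and has no
nontrivial element of finite order. -/
def IsVirtuallyTorsionFreeSolvable (Γ : Type u) [Group Γ] : Prop :=
  ∃ G : Subgroup Γ, G.FiniteIndex ∧ Group.IsSolvable G ∧ ∀ g : G, IsOfFinOrder g → g = 1

/-- The Hirsch rank (Hirsch length) of a solvable group `S`: the sum of the torsion-free ranks
`dim_ℚ (A ⊗ ℚ)` of the factors `A` of an abelian series, taken here along the derived series.
The `ℤ`-module rank of an abelian group (the supremum of the cardinalities of its `ℤ`-linearly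
independent families) is its torsion-free rank. -/
noncomputable def hirschRank (S : Type u) [Group S] : Cardinal.{u} :=
  Cardinal.sum fun n : ℕ => Module.rank ℤ (Additive (Abelianization (derivedSeries S n)))

/-- A (virtually solvable) group has finite Hirsch rank if a solvable subgroup of finite index
does. -/
def HasFiniteHirschRank (Γ : Type u) [Group Γ] : Prop :=
  ∃ S : Subgroup Γ, S.FiniteIndex ∧ Group.IsSolvable S ∧ hirschRank S < Cardinal.aleph0

/-- The poset `𝓕_H`, ordered by inclusion, of the finite subgroups of `Γ` that properly
contain `H`. -/
abbrev FiniteSubgroupsAbove {Γ : Type u} [Group Γ] (H : Subgroup Γ) : Type u :=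
  {K : Subgroup Γ // H < K ∧ Finite K}

/-- The geometric realization `|P|` of a poset `P`: the geometric realization of its nerve, the
simplicial set whose `n`-simplices are the chains `p₀ ≤ ⋯ ≤ pₙ` in `P`. -/
noncomputable abbrev posetRealization (P : Type u) [PartialOrder P] : TopCat.{u} :=
  SSet.toTop.{u}.obj (CategoryTheory.nerve P)

/-! Once all joins `T ⊔ K` are finite, `K ≤ T ⊔ K ≥ T` is a conical contraction of the poset:
comparable monotone maps have homotopic realizations (`realizationMap_homotopic`), so the identity
is homotopic to a constant.

Finiteness of `T ⊔ L` goes by induction on the derived length of a solvable normal subgroup `G` of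
finite index. The invariant that survives quotients is that abelian sections have finite rank and
the torsion radical is finite. After dividing by the radical, let `A` be the last derived term of
`G`. The quotient by `A` may have infinite torsion radical, so `A` is enlarged to its torsion hull
`B`. This is still torsion-free abelian (transfer to a centre of finite index), and the radical of
`Γ ⧸ B` is finite: Minkowski bounds the finite subgroups of `MulAut B`, so a torsion solvable group
acts on `B` through a finite group.

The centralizer condition descends to `Γ ⧸ B` because `H¹(H, B)` is finite
(`relIndex_centralizer_sup_ker_of_torsionFree`): it is killed by `|H|`, and `B` modulo `m`-th powers
is finite by finite rank. By induction the image of `Δ = T ⊔ L` is finite, so `M = Δ ∩ B` has finite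
index `q` in `Δ`.

To lift finiteness (`finite_of_sup_eq_top`), extend `m ↦ m ^ q` from `M` to a crossed homomorphism
`c` on `Δ`. Some power `c ^ p` is a coboundary on `T` and on `L`. The two witnesses differ by an
element fixed by `H`, and the centralizer condition with uniqueness of roots makes it fixed by `T`.
One witness therefore serves on all of `Δ`. As `M` acts trivially on itself, `m ^ (q * p) = 1` on
`M`, so `M = 1`. -/

open CategoryTheory Simplicial Opposite in
/-- The simplex of the nerve given by a chain. -/
def chainSimplex {P : Type u} [PartialOrder P] {n : ℕ} (p : Fin (n + 1) →o P) :
    (nerve P).obj (op ⦋n⦌) :=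
  p.monotone.functor

open CategoryTheory Simplicial Opposite in
/-- The point with barycentric coordinates `x` of the simplex spanned by the chain `p`. -/
noncomputable def chainPoint {P : Type u} [PartialOrder P] {n : ℕ} (p : Fin (n + 1) →o P)
    (x : stdSimplex ℝ (Fin (n + 1))) : posetRealization P :=
  SSet.toTop.map (SSet.yonedaEquiv.symm (chainSimplex p)) (SimplexCategory.toTopHomeo ⦋n⦌ |>.symm x)

/-! ### Maps out of the realization of a poset, described on chains -/

section chainPoint

open CategoryTheory Simplicial Opposite

variable {P : Type u} [PartialOrder P]

theorem continuous_chainPoint {n : ℕ} (p : Fin (n + 1) →o P) : Continuous (chainPoint p) :=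
  (SSet.toTop.map (SSet.yonedaEquiv.symm (chainSimplex p))).hom.continuous.comp
    (SimplexCategory.toTopHomeo ⦋n⦌).symm.continuous

theorem chainPoint_comp {m n : ℕ} (p : Fin (n + 1) →o P) (θ : Fin (m + 1) →o Fin (n + 1))
    (x : stdSimplex ℝ (Fin (m + 1))) :
    chainPoint (p.comp θ) x = chainPoint p (stdSimplex.map θ x) := by
  have h := SimplexCategory.toTopHomeo_symm_naturality_apply (SimplexCategory.mkHom θ) x
  change _ = SSet.toTop.map (SSet.yonedaEquiv.symm (chainSimplex p))
    ((SimplexCategory.toTopHomeo ⦋n⦌).symm (stdSimplex.map (SimplexCategory.mkHom θ) x))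
  rw [h, ← ConcreteCategory.comp_apply, ← Functor.map_comp,
    SSet.yonedaEquiv_symm_naturality_left]
  rfl

theorem chainSimplex_surjective (n : SimplexCategoryᵒᵖ) (a : (nerve P).obj n) :
    ∃ p : Fin (n.unop.len + 1) →o P, a = chainSimplex p :=
  ⟨⟨a.obj, fun _ _ h => leOfHom (a.map (homOfLE h))⟩, rfl⟩

theorem homEquiv_app_chainSimplex {Z : TopCat.{u}} (F : posetRealization P ⟶ Z) {n : ℕ}
    (p : Fin (n + 1) →o P) (x : stdSimplex ℝ (Fin (n + 1))) :
    TopCat.toSSetObjEquiv Z (op ⦋n⦌)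
      ((sSetTopAdj.homEquiv _ _ F).app (op ⦋n⦌) (chainSimplex p)) x = F (chainPoint p x) := by
  rw [Adjunction.homEquiv_unit]
  rfl

theorem posetRealization_hom_ext {Z : Type u} [TopologicalSpace Z] {F G : C(posetRealization P, Z)}
    (h : ∀ (n : ℕ) (p : Fin (n + 1) →o P) (x : stdSimplex ℝ (Fin (n + 1))),
      F (chainPoint p x) = G (chainPoint p x)) : F = G := by
  suffices TopCat.ofHom F = TopCat.ofHom G from congrArg TopCat.Hom.hom this
  apply (sSetTopAdj.homEquiv (nerve P) (TopCat.of Z)).injective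
  ext n a
  obtain ⟨p, rfl⟩ := chainSimplex_surjective n a
  apply (TopCat.toSSetObjEquiv _ n).injective
  ext x
  exact (homEquiv_app_chainSimplex (TopCat.ofHom F) p x).trans
    ((h _ p x).trans (homEquiv_app_chainSimplex (TopCat.ofHom G) p x).symm)

/-- Such a compatible family is a morphism from the nerve to the singular simplicial set of `Z`; its
adjoint is the map sought. -/
theorem exists_posetRealization_lift {Z : Type u} [TopologicalSpace Z]
    (h : ∀ n : ℕ, (Fin (n + 1) →o P) → C(stdSimplex ℝ (Fin (n + 1)), Z))
    (hnat : ∀ (m n : ℕ) (p : Fin (n + 1) →o P) (θ : Fin (m + 1) →o Fin (n + 1))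
      (x : stdSimplex ℝ (Fin (m + 1))), h m (p.comp θ) x = h n p (stdSimplex.map θ x)) :
    ∃ F : C(posetRealization P, Z), ∀ (n : ℕ) (p : Fin (n + 1) →o P)
      (x : stdSimplex ℝ (Fin (n + 1))), F (chainPoint p x) = h n p x := by
  let φ : nerve P ⟶ TopCat.toSSet.obj (TopCat.of Z) :=
    { app := fun n => ↾fun a => (TopCat.toSSetObjEquiv (TopCat.of Z) n).symm
        (h n.unop.len ⟨a.obj, fun _ _ h => leOfHom (a.map (homOfLE h))⟩)
      naturality := fun n m f => by
        ext a
        apply (TopCat.toSSetObjEquiv _ m).injective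
        ext x
        exact hnat _ _ ⟨a.obj, fun _ _ h => leOfHom (a.map (homOfLE h))⟩
          f.unop.toOrderHom x }
  refine ⟨((sSetTopAdj.homEquiv _ _).symm φ).hom, fun n p x => ?_⟩
  refine (homEquiv_app_chainSimplex ((sSetTopAdj.homEquiv _ _).symm φ) p x).symm.trans ?_
  rw [Equiv.apply_symm_apply]
  rfl

end chainPoint

/-! ### Combinatorics of the prism decomposition -/

section Prism

/-- The chain `f p₀ ≤ ⋯ ≤ f pᵢ ≤ g pᵢ ≤ ⋯ ≤ g pₙ`. -/
def prismChain {P Q : Type*} [PartialOrder P] [PartialOrder Q] {f g : P →o Q} (hfg : f ≤ g)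
    {n : ℕ} (p : Fin (n + 1) →o P) (i : Fin (n + 1)) : Fin (n + 2) →o Q where
  toFun k := if k ≤ i.castSucc then f (p (i.predAbove k)) else g (p (i.predAbove k))
  monotone' k l hkl := by
    have h : p (i.predAbove k) ≤ p (i.predAbove l) := p.monotone (Fin.predAbove_right_monotone i hkl)
    dsimp only
    split_ifs with hk hl hl
    · exact f.monotone h
    · exact (f.monotone h).trans (hfg _)
    · exact absurd (hkl.trans hl) hk
    · exact g.monotone h

theorem Fin.castSuccOrderHom_le_succOrderHom (n : ℕ) :
    (Fin.castSuccOrderEmb : Fin n ↪o Fin (n + 1)).toOrderHom ≤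
      (Fin.succOrderEmb n).toOrderHom :=
  fun i => (Fin.castSucc_lt_succ (i := i)).le

variable {P Q : Type*} [PartialOrder P] [PartialOrder Q] {f g : P →o Q} (hfg : f ≤ g)

theorem prismChain_apply {n : ℕ} (p : Fin (n + 1) →o P) (i : Fin (n + 1)) (k : Fin (n + 2)) :
    prismChain hfg p i k =
      if k ≤ i.castSucc then f (p (i.predAbove k)) else g (p (i.predAbove k)) :=
  rfl

theorem prismChain_castSucc {n : ℕ} (p : Fin (n + 1) →o P) {i k : Fin (n + 1)} (h : k ≤ i) :
    prismChain hfg p i k.castSucc = f (p k) := by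
  rw [prismChain_apply, if_pos (Fin.castSucc_le_castSucc_iff.2 h),
    Fin.predAbove_of_le_castSucc _ _ (Fin.castSucc_le_castSucc_iff.2 h), Fin.castPred_castSucc]

theorem prismChain_succ {n : ℕ} (p : Fin (n + 1) →o P) {i k : Fin (n + 1)} (h : i ≤ k) :
    prismChain hfg p i k.succ = g (p k) := by
  have h2 : i.castSucc < k.succ := Fin.castSucc_lt_succ_iff.2 h
  rw [prismChain_apply, if_neg (not_le.2 h2), Fin.predAbove_of_castSucc_lt _ _ h2, Fin.pred_succ]

theorem Fin.eq_castSucc_or_eq_succ {n : ℕ} (i : Fin (n + 1)) (k : Fin (n + 2)) :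
    (∃ l ≤ i, k = l.castSucc) ∨ ∃ l, i ≤ l ∧ k = l.succ := by
  rcases le_or_gt k i.castSucc with h | h
  · exact Or.inl ⟨k.castPred (ne_of_lt (h.trans_lt i.castSucc_lt_last)),
      (Fin.castPred_le_iff _).2 h, by simp⟩
  · exact Or.inr ⟨k.pred (ne_of_gt ((Fin.zero_le _).trans_lt h)), (Fin.le_pred_iff _).2 h, by simp⟩

/-- The prism chain of the two inclusions `castSucc ≤ succ` is the universal prism operator. This
naturality covers degenerate `θ` as well, so the homotopies on simplices will glue. -/
theorem prismChain_comp {m n : ℕ} (p : Fin (n + 1) →o P) (θ : Fin (m + 1) →o Fin (n + 1))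
    (j : Fin (m + 1)) :
    (prismChain hfg p (θ j)).comp (prismChain (Fin.castSuccOrderHom_le_succOrderHom _) θ j) =
      prismChain hfg (p.comp θ) j := by
  ext k
  rw [OrderHom.comp_coe, Function.comp_apply]
  rcases Fin.eq_castSucc_or_eq_succ j k with ⟨l, hl, rfl⟩ | ⟨l, hl, rfl⟩
  · rw [prismChain_castSucc _ _ hl, prismChain_castSucc _ _ hl]
    exact prismChain_castSucc _ _ (θ.monotone hl)
  · rw [prismChain_succ _ _ hl, prismChain_succ _ _ hl]
    exact prismChain_succ _ _ (θ.monotone hl)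

theorem Fin.succ_succAbove_eq_ite {n : ℕ} (i k : Fin (n + 1)) :
    i.succ.succAbove k = if k ≤ i then k.castSucc else k.succ := by
  split_ifs with h
  · exact Fin.succAbove_of_castSucc_lt _ _ (Fin.castSucc_lt_succ_iff.2 h)
  · exact Fin.succAbove_of_le_castSucc _ _ (Fin.succ_le_castSucc_iff.2 (not_le.1 h))

theorem prismChain_succ_succAbove {n : ℕ} (p : Fin (n + 1) →o P) (i k : Fin (n + 1)) :
    prismChain hfg p i (i.succ.succAbove k) = if k ≤ i then f (p k) else g (p k) := by
  rw [Fin.succ_succAbove_eq_ite]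
  split_ifs with h
  · exact prismChain_castSucc _ _ h
  · exact prismChain_succ _ _ (not_le.1 h).le

theorem prismChain_castSucc_succAbove {n : ℕ} (p : Fin (n + 1) →o P) (i k : Fin (n + 1)) :
    prismChain hfg p i (i.castSucc.succAbove k) = if k < i then f (p k) else g (p k) := by
  split_ifs with h
  · rw [Fin.succAbove_of_castSucc_lt _ _ (Fin.castSucc_lt_castSucc_iff.2 h)]
    exact prismChain_castSucc _ _ h.le
  · rw [Fin.succAbove_of_le_castSucc _ _ (Fin.castSucc_le_castSucc_iff.2 (not_lt.1 h))]
    exact prismChain_succ _ _ (not_lt.1 h)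

end Prism

/-! ### Barycentric coordinates and partial sums -/

section Weights

open Finset

theorem stdSimplex_sum_map_mul {m n : ℕ} (θ : Fin m → Fin n) (x : stdSimplex ℝ (Fin m))
    (φ : Fin n → ℝ) : ∑ l, stdSimplex.map θ x l * φ l = ∑ k, x k * φ (θ k) := by
  have : ∀ l, stdSimplex.map θ x l = ∑ k, if θ k = l then x k else 0 := fun l => by
    rw [stdSimplex.map_coe, FunOnFinite.linearMap_apply_apply, Finset.sum_filter]
  simp_rw [this, sum_mul]
  rw [sum_comm]
  refine sum_congr rfl fun k _ => ?_
  simp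

theorem stdSimplex_ext_of_sum {n : ℕ} {x y : stdSimplex ℝ (Fin n)}
    (h : ∀ φ : Fin n → ℝ, ∑ k, x k * φ k = ∑ k, y k * φ k) : x = y := by
  apply stdSimplex.ext
  ext k
  simpa [Pi.single_apply] using h (Pi.single k 1)

variable {n : ℕ}

/-- The mass of the first vertices of a simplex, up to and including the `i`-th. -/
def massLE (x : stdSimplex ℝ (Fin (n + 1))) (i : Fin (n + 1)) : ℝ :=
  ∑ k, x k * if k ≤ i then 1 else 0

/-- The mass of the vertices of a simplex before the `i`-th. -/
def massLT (x : stdSimplex ℝ (Fin (n + 1))) (i : Fin (n + 1)) : ℝ :=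
  ∑ k, x k * if k < i then 1 else 0

theorem massLE_eq (x : stdSimplex ℝ (Fin (n + 1))) (i : Fin (n + 1)) :
    massLE x i = massLT x i + x i := by
  have : x i = ∑ k, x k * if k = i then 1 else 0 := by simp
  rw [this, massLE, massLT, ← sum_add_distrib]
  refine sum_congr rfl fun k _ => ?_
  rw [← mul_add]
  congr 1
  rcases lt_trichotomy k i with h | h | h
  · simp [h, h.le, h.ne]
  · simp [h]
  · simp [h.not_gt, h.not_ge, h.ne']

@[fun_prop]
theorem continuous_massLE (i : Fin (n + 1)) :
    Continuous fun x : stdSimplex ℝ (Fin (n + 1)) => massLE x i := by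
  unfold massLE
  refine continuous_finsetSum _ fun k _ => ?_
  exact ((continuous_apply k).comp continuous_subtype_val).mul continuous_const

@[fun_prop]
theorem continuous_massLT (i : Fin (n + 1)) :
    Continuous fun x : stdSimplex ℝ (Fin (n + 1)) => massLT x i := by
  unfold massLT
  refine continuous_finsetSum _ fun k _ => ?_
  exact ((continuous_apply k).comp continuous_subtype_val).mul continuous_const

/-- The intervals `[massLT x i, massLE x i]` tile `[0, 1]`; the tile containing `c` selects the
prism simplex used at that height. -/
theorem exists_massLT_le_le_massLE (x : stdSimplex ℝ (Fin (n + 1))) {c : ℝ} (h0 : 0 ≤ c)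
    (h1 : c ≤ 1) : ∃ i, massLT x i ≤ c ∧ c ≤ massLE x i := by
  have hlast : massLE x (Fin.last n) = 1 := by
    simp [massLE, Fin.le_last]
  by_contra! H
  have : ∀ i : Fin (n + 1), massLT x i ≤ c := by
    intro i
    induction i using Fin.induction with
    | zero => simpa [massLT] using h0
    | succ i ih =>
      have : massLT x i.succ = massLE x i.castSucc := by
        simp [massLE, massLT, Fin.lt_def, Fin.le_def]
      rw [this]
      exact (H _ ih).le
  exact absurd (H _ (this (Fin.last n))) (by rw [hlast]; exact not_lt.2 h1)

/-- Split the mass at the `i`-th vertex into two parts, the second of which is `a`. -/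
noncomputable def splitMass (x : stdSimplex ℝ (Fin (n + 1))) (i : Fin (n + 1)) (a : ℝ)
    (h0 : 0 ≤ a) (h1 : a ≤ x i) : stdSimplex ℝ (Fin (n + 2)) :=
  ⟨i.succ.insertNth a fun k => x k - (Pi.single i a : Fin (n + 1) → ℝ) k, fun k => by
    refine Fin.succAboveCases i.succ ?_ (fun l => ?_) k
    · simpa using h0
    · rcases eq_or_ne l i with rfl | hl
      · have := h1
        rw [← sub_nonneg] at this
        rw [Fin.insertNth_apply_succAbove]
        simpa using this
      · rw [Fin.insertNth_apply_succAbove]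
        simp [hl, stdSimplex.zero_le], by
    rw [Fin.sum_univ_succAbove _ i.succ]
    simp⟩

theorem sum_splitMass_mul (x : stdSimplex ℝ (Fin (n + 1))) (i : Fin (n + 1)) (a : ℝ)
    (h0 : 0 ≤ a) (h1 : a ≤ x i) (φ : Fin (n + 2) → ℝ) :
    ∑ k, splitMass x i a h0 h1 k * φ k =
      ∑ k, x k * φ (i.succ.succAbove k) + a * (φ i.succ - φ i.castSucc) := by
  have h : ∀ k, splitMass x i a h0 h1 k =
      (i.succ.insertNth a fun k => x k - (Pi.single i a : Fin (n + 1) → ℝ) k : Fin (n + 2) → ℝ) k :=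
    fun _ => rfl
  rw [Fin.sum_univ_succAbove _ i.succ]
  simp only [h, Fin.insertNth_apply_same, Fin.insertNth_apply_succAbove, sub_mul,
    sum_sub_distrib]
  have : ∑ k, (Pi.single i a : Fin (n + 1) → ℝ) k * φ (i.succ.succAbove k) = a * φ i.castSucc := by
    rw [sum_eq_single i]
    · simp
    · intro b _ hb; simp [hb]
    · simp
  rw [this]; ring

theorem continuous_splitMass {X : Type*} [TopologicalSpace X]
    {x : X → stdSimplex ℝ (Fin (n + 1))} (hx : Continuous x) (i : Fin (n + 1)) {a : X → ℝ}
    (ha : Continuous a) (h0 : ∀ t, 0 ≤ a t) (h1 : ∀ t, a t ≤ x t i) :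
    Continuous fun t => splitMass (x t) i (a t) (h0 t) (h1 t) := by
  refine Continuous.subtype_mk (Continuous.finInsertNth _ ha (continuous_pi fun k => ?_)) _
  refine Continuous.sub ((continuous_apply k).comp (continuous_subtype_val.comp hx)) ?_
  rcases eq_or_ne k i with rfl | hk
  · simpa using ha
  · simpa [hk] using continuous_const

end Weights

/-! ### Points of the prism and their gluing -/

section PrismPoint

variable {P Q : Type u} [PartialOrder P] [PartialOrder Q] {f g : P →o Q} (hfg : f ≤ g)
variable {n : ℕ}

/-- The point of the realization at height `1 - c` over the point `x` of the simplex `p`, in the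
homotopy from `f` to `g`, provided that `massLT x i ≤ c ≤ massLE x i`. -/
noncomputable def prismPoint (p : Fin (n + 1) →o P) (i : Fin (n + 1))
    (x : stdSimplex ℝ (Fin (n + 1))) (c : ℝ) : posetRealization Q :=
  chainPoint (prismChain hfg p i) (splitMass x i (max 0 (min (x i) (massLE x i - c)))
    (le_max_left _ _) (max_le (stdSimplex.zero_le x i) (min_le_left _ _)))

theorem continuous_prismPoint (p : Fin (n + 1) →o P) (i : Fin (n + 1)) :
    Continuous fun t : stdSimplex ℝ (Fin (n + 1)) × ℝ => prismPoint hfg p i t.1 t.2 := by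
  refine (continuous_chainPoint _).comp (continuous_splitMass continuous_fst i ?_ _ _)
  have : Continuous fun t : stdSimplex ℝ (Fin (n + 1)) × ℝ => t.1 i :=
    (continuous_apply i).comp (continuous_subtype_val.comp continuous_fst)
  fun_prop

/-- The clamp in `prismPoint` makes it total and continuous; on the tile of `i` it is inactive. -/
theorem prismPoint_eq (p : Fin (n + 1) →o P) {i : Fin (n + 1)}
    {x : stdSimplex ℝ (Fin (n + 1))} {c a : ℝ} (ha : massLE x i - c = a) (h0 : 0 ≤ a)
    (h1 : a ≤ x i) :
    prismPoint hfg p i x c = chainPoint (prismChain hfg p i) (splitMass x i a h0 h1) := by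
  have h : max 0 (min (x i) (massLE x i - c)) = a := by
    rw [ha, min_eq_right h1, max_eq_right h0]
  simp only [prismPoint, h]

theorem chainPoint_congr {m : ℕ} {p : Fin (m + 1) →o Q} {x y : stdSimplex ℝ (Fin (m + 1))}
    (h : ∀ φ : Fin (m + 1) → ℝ, ∑ k, x k * φ k = ∑ k, y k * φ k) :
    chainPoint p x = chainPoint p y := by
  rw [stdSimplex_ext_of_sum h]

/-- The increasing map onto the complement of a vertex. -/
def Fin.succAboveOrderHom {n : ℕ} (i : Fin (n + 1)) : Fin n →o Fin (n + 1) :=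
  ⟨i.succAbove, (Fin.strictMono_succAbove i).monotone⟩

theorem prismPoint_eq_of_massLE_eq (p : Fin (n + 1) →o P) {i : Fin (n + 1)}
    {x : stdSimplex ℝ (Fin (n + 1))} {c : ℝ} (h : massLE x i = c) :
    prismPoint hfg p i x c =
      chainPoint ((prismChain hfg p i).comp (Fin.succAboveOrderHom i.succ)) x := by
  rw [prismPoint_eq hfg p (a := 0) (sub_eq_zero.2 h) le_rfl (stdSimplex.zero_le x i),
    chainPoint_comp]
  refine chainPoint_congr fun φ => ?_
  rw [stdSimplex_sum_map_mul, sum_splitMass_mul]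
  simp [Fin.succAboveOrderHom]

theorem prismPoint_eq_of_massLT_eq (p : Fin (n + 1) →o P) {i : Fin (n + 1)}
    {x : stdSimplex ℝ (Fin (n + 1))} {c : ℝ} (h : massLT x i = c) :
    prismPoint hfg p i x c =
      chainPoint ((prismChain hfg p i).comp (Fin.succAboveOrderHom i.castSucc)) x := by
  rw [prismPoint_eq hfg p (a := x i) (by rw [massLE_eq, h]; ring) (stdSimplex.zero_le x i) le_rfl,
    chainPoint_comp]
  refine chainPoint_congr fun φ => ?_
  rw [stdSimplex_sum_map_mul, sum_splitMass_mul]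
  have : x i * (φ i.succ - φ i.castSucc) =
      ∑ k, x k * if k = i then φ i.succ - φ i.castSucc else 0 := by simp
  rw [this, ← Finset.sum_add_distrib]
  refine Finset.sum_congr rfl fun k _ => ?_
  rw [← mul_add]
  congr 1
  simp only [Fin.succAboveOrderHom, OrderHom.coe_mk]
  rcases lt_trichotomy k i with hk | rfl | hk
  · rw [Fin.succAbove_of_castSucc_lt _ _ (Fin.castSucc_lt_castSucc_iff.2 hk),
      Fin.succ_succAbove_eq_ite, if_pos hk.le, if_neg hk.ne, add_zero]
  · simp
  · rw [Fin.succAbove_of_le_castSucc _ _ (Fin.castSucc_le_castSucc_iff.2 hk.le),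
      Fin.succ_succAbove_eq_ite, if_neg (not_le.2 hk), if_neg hk.ne', add_zero]

theorem massLT_succ (x : stdSimplex ℝ (Fin (n + 1))) (i : Fin n) :
    massLT x i.succ = massLE x i.castSucc := by
  simp [massLE, massLT, Fin.lt_def, Fin.le_def]

theorem massLE_le_massLT (x : stdSimplex ℝ (Fin (n + 1))) {i j : Fin (n + 1)} (h : i < j) :
    massLE x i ≤ massLT x j := by
  refine Finset.sum_le_sum fun k _ => mul_le_mul_of_nonneg_left ?_ (stdSimplex.zero_le x k)
  by_cases hk : k ≤ i
  · simp [hk, hk.trans_lt h]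
  · simp only [hk, if_false]
    split_ifs <;> norm_num

theorem massLT_le_massLE (x : stdSimplex ℝ (Fin (n + 1))) (i : Fin (n + 1)) :
    massLT x i ≤ massLE x i := by
  rw [massLE_eq]
  linarith [stdSimplex.zero_le x i]

/-- On the common wall the split vertex has all its mass on one side, and both prism simplices
restrict to the same face. -/
theorem prismPoint_castSucc_eq_succ (p : Fin (n + 1) →o P) (i : Fin n)
    {x : stdSimplex ℝ (Fin (n + 1))} {c : ℝ} (h : massLE x i.castSucc = c) :
    prismPoint hfg p i.castSucc x c = prismPoint hfg p i.succ x c := by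
  rw [prismPoint_eq_of_massLE_eq hfg p h,
    prismPoint_eq_of_massLT_eq hfg p ((massLT_succ x i).trans h)]
  congr 1
  ext k
  simp only [OrderHom.comp_coe, Function.comp_apply, Fin.succAboveOrderHom, OrderHom.coe_mk]
  rw [prismChain_succ_succAbove, prismChain_castSucc_succAbove]
  simp only [Fin.lt_def, Fin.le_def, Fin.val_castSucc, Fin.val_succ, Nat.lt_succ_iff]

/-- If `i < j`, the hypotheses squeeze `c` to `massLE x i = massLT x j`, so no vertex strictly
between carries mass. One walks from `i` to `j` across walls all at height `c`. -/
theorem prismPoint_eq_of_lt (p : Fin (n + 1) →o P) {x : stdSimplex ℝ (Fin (n + 1))} {c : ℝ}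
    {i j : Fin (n + 1)} (hij : i ≤ j) (hi : c ≤ massLE x i) (hj : massLT x j ≤ c) :
    prismPoint hfg p i x c = prismPoint hfg p j x c := by
  induction j using Fin.induction with
  | zero => rw [Fin.le_zero_iff.1 hij]
  | succ j ih =>
    rcases hij.eq_or_lt with rfl | hlt
    · rfl
    · have hle : i ≤ j.castSucc := Fin.le_castSucc_iff.2 hlt
      have h1 : massLE x j.castSucc ≤ c := by rwa [← massLT_succ]
      have h2 : massLE x i ≤ massLE x j.castSucc := by
        rcases hle.eq_or_lt with rfl | h
        · exact le_rfl
        · exact (massLE_le_massLT x h).trans (massLT_le_massLE x _)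
      rw [ih hle ((massLT_le_massLE x _).trans h1)]
      exact prismPoint_castSucc_eq_succ hfg p j (le_antisymm h1 (hi.trans h2))

theorem prismPoint_eq_prismPoint (p : Fin (n + 1) →o P) {x : stdSimplex ℝ (Fin (n + 1))} {c : ℝ}
    {i j : Fin (n + 1)} (hi : massLT x i ≤ c ∧ c ≤ massLE x i)
    (hj : massLT x j ≤ c ∧ c ≤ massLE x j) :
    prismPoint hfg p i x c = prismPoint hfg p j x c := by
  rcases le_total i j with h | h
  · exact prismPoint_eq_of_lt hfg p h hi.2 hj.1
  · exact (prismPoint_eq_of_lt hfg p h hj.2 hi.1).symm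

theorem massLE_map {m n : ℕ} (θ : Fin (m + 1) →o Fin (n + 1)) (y : stdSimplex ℝ (Fin (m + 1)))
    (i : Fin (n + 1)) : massLE (stdSimplex.map θ y) i = ∑ k, y k * if θ k ≤ i then 1 else 0 :=
  stdSimplex_sum_map_mul _ _ _

theorem massLT_map {m n : ℕ} (θ : Fin (m + 1) →o Fin (n + 1)) (y : stdSimplex ℝ (Fin (m + 1)))
    (i : Fin (n + 1)) : massLT (stdSimplex.map θ y) i = ∑ k, y k * if θ k < i then 1 else 0 :=
  stdSimplex_sum_map_mul _ _ _

theorem massLE_le_massLE_map {m n : ℕ} (θ : Fin (m + 1) →o Fin (n + 1))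
    (y : stdSimplex ℝ (Fin (m + 1))) (j : Fin (m + 1)) :
    massLE y j ≤ massLE (stdSimplex.map θ y) (θ j) := by
  rw [massLE_map]
  refine Finset.sum_le_sum fun k _ => mul_le_mul_of_nonneg_left ?_ (stdSimplex.zero_le y k)
  by_cases hk : k ≤ j
  · simp [hk, θ.monotone hk]
  · simp only [hk, if_false]
    split_ifs <;> norm_num

theorem massLT_map_le_massLT {m n : ℕ} (θ : Fin (m + 1) →o Fin (n + 1))
    (y : stdSimplex ℝ (Fin (m + 1))) (j : Fin (m + 1)) :
    massLT (stdSimplex.map θ y) (θ j) ≤ massLT y j := by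
  rw [massLT_map]
  refine Finset.sum_le_sum fun k _ => mul_le_mul_of_nonneg_left ?_ (stdSimplex.zero_le y k)
  by_cases hk : θ k < θ j
  · simp [hk, θ.monotone.reflect_lt hk]
  · simp only [hk, if_false]
    split_ifs <;> norm_num

theorem prismPoint_comp {m n : ℕ} (p : Fin (n + 1) →o P) (θ : Fin (m + 1) →o Fin (n + 1))
    (y : stdSimplex ℝ (Fin (m + 1))) {c : ℝ} {j : Fin (m + 1)}
    (hj : massLT y j ≤ c ∧ c ≤ massLE y j) :
    prismPoint hfg (p.comp θ) j y c = prismPoint hfg p (θ j) (stdSimplex.map θ y) c := by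
  have h1 := massLE_le_massLE_map θ y j
  have h2 := massLT_map_le_massLT θ y j
  have h3 := massLE_eq y j
  have h4 := massLE_eq (stdSimplex.map θ y) (θ j)
  rw [prismPoint_eq hfg _ rfl (sub_nonneg.2 hj.2) (by linarith [hj.1]),
    prismPoint_eq hfg _ rfl (by linarith [hj.2]) (by linarith [hj.1]),
    ← prismChain_comp, chainPoint_comp]
  refine chainPoint_congr fun φ => ?_
  rw [stdSimplex_sum_map_mul, sum_splitMass_mul, sum_splitMass_mul, stdSimplex_sum_map_mul,
    prismChain_castSucc _ _ le_rfl, prismChain_succ _ _ le_rfl, massLE_map, massLE]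
  change _ + _ * (φ (θ j).succ - φ (θ j).castSucc) = _
  rw [← sub_eq_zero]
  set d := φ (θ j).succ - φ (θ j).castSucc with hd
  -- Once tested against `φ`, the two sides agree vertex by vertex; the mass terms compensate for
  -- those `k > j` which `θ` identifies with `j`.
  have key : ∀ k, φ (prismChain (Fin.castSuccOrderHom_le_succOrderHom _) θ j (j.succ.succAbove k))
      - φ ((θ j).succ.succAbove (θ k)) + (if k ≤ j then 1 else 0) * d
      - (if θ k ≤ θ j then 1 else 0) * d = 0 := by
    intro k
    rw [prismChain_succ_succAbove, Fin.succ_succAbove_eq_ite]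
    by_cases hk : k ≤ j
    · have := θ.monotone hk
      simp only [hk, this, if_true]
      change φ (θ k).castSucc - _ + _ - _ = 0
      ring
    · have h5 := θ.monotone (not_le.1 hk).le
      simp only [hk, if_false]
      change φ (θ k).succ - _ + _ - _ = 0
      by_cases h6 : θ k ≤ θ j
      · simp only [le_antisymm h6 h5, le_refl, if_true, hd]
        ring
      · simp only [h6, if_false]
        ring
  calc _ = ∑ k, y k * (φ (prismChain (Fin.castSuccOrderHom_le_succOrderHom _) θ j
        (j.succ.succAbove k)) - φ ((θ j).succ.succAbove (θ k)) + (if k ≤ j then 1 else 0) * d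
        - (if θ k ≤ θ j then 1 else 0) * d) := by
        simp only [mul_sub, mul_add, Finset.sum_sub_distrib, Finset.sum_add_distrib, ← mul_assoc,
          ← Finset.sum_mul]
        ring
    _ = 0 := by simp only [key, mul_zero, Finset.sum_const_zero]

end PrismPoint

/-! ### Homotopies between realizations of comparable monotone maps -/

section PosetHomotopy

variable {P Q : Type u} [PartialOrder P] [PartialOrder Q]

open scoped unitInterval

theorem exists_prism {f g : P →o Q} (hfg : f ≤ g) {n : ℕ} (p : Fin (n + 1) →o P) :
    ∃ K : C(stdSimplex ℝ (Fin (n + 1)) × I, posetRealization Q),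
      ∀ (x : stdSimplex ℝ (Fin (n + 1))) (s : I) (i : Fin (n + 1)),
        massLT x i ≤ s ∧ s ≤ massLE x i → K (x, s) = prismPoint hfg p i x s := by
  choose i hi using fun t : stdSimplex ℝ (Fin (n + 1)) × I =>
    exists_massLT_le_le_massLE t.1 t.2.2.1 t.2.2.2
  let C : Fin (n + 1) → Set (stdSimplex ℝ (Fin (n + 1)) × I) := fun j =>
    {t | massLT t.1 j ≤ t.2 ∧ (t.2 : ℝ) ≤ massLE t.1 j}
  have hs : Continuous fun t : stdSimplex ℝ (Fin (n + 1)) × I => (t.2 : ℝ) := by fun_prop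
  have hC : ∀ j, IsClosed (C j) := fun j =>
    (isClosed_le ((continuous_massLT j).comp continuous_fst) hs).inter
      (isClosed_le hs ((continuous_massLE j).comp continuous_fst))
  have hcont : Continuous fun t : stdSimplex ℝ (Fin (n + 1)) × I =>
      prismPoint hfg p (i t) t.1 t.2 := by
    refine (locallyFinite_of_finite C).continuous ?_ hC fun j => ?_
    · exact Set.eq_univ_of_forall fun t => Set.mem_iUnion.2 ⟨i t, hi t⟩
    · have : Continuous fun t : stdSimplex ℝ (Fin (n + 1)) × I => prismPoint hfg p j t.1 t.2 :=
        (continuous_prismPoint hfg p j).comp (by fun_prop :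
          Continuous fun t : stdSimplex ℝ (Fin (n + 1)) × I => (t.1, (t.2 : ℝ)))
      exact this.continuousOn.congr fun t ht => prismPoint_eq_prismPoint hfg p (hi t) ht
  exact ⟨⟨_, hcont⟩, fun x s j hj => prismPoint_eq_prismPoint hfg p (hi (x, s)) hj⟩

theorem exists_realizationMap (f : P →o Q) :
    ∃ F : C(posetRealization P, posetRealization Q), ∀ (n : ℕ) (p : Fin (n + 1) →o P)
      (x : stdSimplex ℝ (Fin (n + 1))), F (chainPoint p x) = chainPoint (f.comp p) x :=
  exists_posetRealization_lift (fun _ p => ⟨_, continuous_chainPoint (f.comp p)⟩)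
    fun _ _ p θ x => chainPoint_comp (f.comp p) θ x

/-- The map of realizations induced by a monotone map. -/
noncomputable def realizationMap (f : P →o Q) : C(posetRealization P, posetRealization Q) :=
  (exists_realizationMap f).choose

@[simp]
theorem realizationMap_chainPoint (f : P →o Q) {n : ℕ} (p : Fin (n + 1) →o P)
    (x : stdSimplex ℝ (Fin (n + 1))) :
    realizationMap f (chainPoint p x) = chainPoint (f.comp p) x :=
  (exists_realizationMap f).choose_spec n p x

theorem massLE_last {n : ℕ} (x : stdSimplex ℝ (Fin (n + 1))) : massLE x (Fin.last n) = 1 := by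
  simp [massLE, Fin.le_last]

theorem massLT_zero {n : ℕ} (x : stdSimplex ℝ (Fin (n + 1))) : massLT x 0 = 0 := by
  simp [massLT]

theorem realizationMap_homotopic {f g : P →o Q} (hfg : f ≤ g) :
    (realizationMap f).Homotopic (realizationMap g) := by
  choose K hK using fun n => exists_prism (n := n) hfg
  -- The homotopy is built in curried form, since maps out of the realization, unlike those out of
  -- its product with `I`, are directly given on simplices. The parameter `s` is the mass carried by
  -- `f`, so it runs from `g` to `f`.
  obtain ⟨F, hF⟩ := exists_posetRealization_lift (P := P) (Z := C(I, posetRealization Q))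
    (fun n p => (K n p).curry) fun m n p θ x => by
      ext s
      obtain ⟨j, hj⟩ := exists_massLT_le_le_massLE x s.2.1 s.2.2
      have hj' : massLT (stdSimplex.map θ x) (θ j) ≤ s ∧ s ≤ massLE (stdSimplex.map θ x) (θ j) :=
        ⟨(massLT_map_le_massLT θ x j).trans hj.1, hj.2.trans (massLE_le_massLE_map θ x j)⟩
      simp only [ContinuousMap.curry_apply]
      rw [hK m _ x s j hj, hK n p _ s _ hj', prismPoint_comp hfg p θ x hj]
  have h0 : ∀ y, F y 0 = realizationMap g y := by
    refine DFunLike.congr_fun (f := (⟨fun y => F y 0, by fun_prop⟩ : C(_, _)))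
      (posetRealization_hom_ext fun n p x => ?_)
    have hx : massLT x 0 ≤ (0 : I) ∧ ((0 : I) : ℝ) ≤ massLE x 0 := by
      refine ⟨(massLT_zero x).le, ?_⟩
      have := massLT_le_massLE x 0
      rwa [massLT_zero] at this
    simp only [ContinuousMap.coe_mk, hF, ContinuousMap.curry_apply, realizationMap_chainPoint]
    rw [hK n p x 0 0 hx, Set.Icc.coe_zero, prismPoint_eq_of_massLT_eq hfg p (massLT_zero x)]
    congr 1
  have h1 : ∀ y, F y 1 = realizationMap f y := by
    refine DFunLike.congr_fun (f := (⟨fun y => F y 1, by fun_prop⟩ : C(_, _)))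
      (posetRealization_hom_ext fun n p x => ?_)
    have hx : massLT x (Fin.last n) ≤ (1 : I) ∧ ((1 : I) : ℝ) ≤ massLE x (Fin.last n) := by
      refine ⟨?_, (massLE_last x).ge⟩
      have := massLT_le_massLE x (Fin.last n)
      rwa [massLE_last] at this
    simp only [ContinuousMap.coe_mk, hF, ContinuousMap.curry_apply, realizationMap_chainPoint]
    rw [hK n p x 1 _ hx, Set.Icc.coe_one, prismPoint_eq_of_massLE_eq hfg p (massLE_last x)]
    congr 1
    ext k
    exact (prismChain_succ_succAbove hfg p _ k).trans (if_pos (Fin.le_last k))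
  exact ContinuousMap.Homotopic.symm ⟨⟨⟨fun t => F t.2 t.1, by fun_prop⟩, h0, h1⟩⟩

theorem realizationMap_id : realizationMap (OrderHom.id : P →o P) = ContinuousMap.id _ :=
  posetRealization_hom_ext fun n p x => by
    simp

theorem realizationMap_const (q : Q) :
    ∃ y, realizationMap (OrderHom.const P q) = ContinuousMap.const _ y := by
  refine ⟨chainPoint (OrderHom.const (Fin 1) q) default, posetRealization_hom_ext fun n p x => ?_⟩
  have := chainPoint_comp (OrderHom.const (Fin 1) q) (OrderHom.const (Fin (n + 1)) 0) x
  rw [realizationMap_chainPoint, ContinuousMap.const_apply]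
  exact this.trans (congrArg _ (Subsingleton.elim _ _))

/-- A conically contractible poset has contractible realization. -/
theorem contractibleSpace_posetRealization (f : P →o P) (t : P) (hid : ∀ p, p ≤ f p)
    (ht : ∀ p, t ≤ f p) : ContractibleSpace (posetRealization P) := by
  rw [contractible_iff_id_nullhomotopic]
  obtain ⟨y, hy⟩ := realizationMap_const (P := P) t
  refine ⟨y, ?_⟩
  rw [← hy, ← realizationMap_id]
  exact (realizationMap_homotopic (f := OrderHom.id) (g := f) hid).trans
    (realizationMap_homotopic (f := OrderHom.const P t) (g := f) ht).symm

end PosetHomotopy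

/-! ### Crossed homomorphisms, and finiteness of a join over an abelian subgroup -/

section Cocycle

/-- Multiply the cocycle identity over `k` and reindex by `k ↦ h * k`. -/
theorem cocycle_pow_card_mul {K N : Type*} [Group K] [Fintype K] [CommGroup N]
    (ρ : K →* MulAut N) (c : K → N) (hc : ∀ h k, c (h * k) = c h * ρ h (c k)) (h : K) :
    c h ^ Fintype.card K * ρ h (∏ k, c k) = ∏ k, c k := by
  conv_rhs => rw [← Equiv.prod_comp (Equiv.mulLeft h) c]
  simp only [Equiv.coe_mulLeft, hc, Finset.prod_mul_distrib, Finset.prod_const, Finset.card_univ,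
    map_prod]

/-- The stabilizer of `b` for the affine action of `Δ` on `N` given by a crossed homomorphism. -/
def cocycleStabilizer {Δ N : Type*} [Group Δ] [CommGroup N] (ρ : Δ →* MulAut N) (c : Δ → N)
    (hc : ∀ h k, c (h * k) = c h * ρ h (c k)) (b : N) : Subgroup Δ where
  carrier := {δ | c δ * ρ δ b = b}
  mul_mem' {δ ε} hδ hε := by
    change c δ * ρ δ b = b at hδ
    change c ε * ρ ε b = b at hε
    change c (δ * ε) * ρ (δ * ε) b = b
    rw [hc, map_mul, MulAut.mul_apply, mul_assoc, ← map_mul, hε, hδ]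
  one_mem' := by
    have : c 1 = 1 := by simpa using hc 1 1
    simp [this]
  inv_mem' {δ} hδ := by
    change c δ * ρ δ b = b at hδ
    change c δ⁻¹ * ρ δ⁻¹ b = b
    have h0 : c 1 = 1 := by simpa using hc 1 1
    have h1 : c δ⁻¹ * ρ δ⁻¹ (c δ) = 1 := by rw [← hc, inv_mul_cancel, h0]
    have h2 : ρ δ⁻¹ (ρ δ b) = b := by
      rw [← MulAut.mul_apply, ← map_mul, inv_mul_cancel, map_one, MulAut.one_apply]
    nth_rw 1 [← hδ]
    rw [map_mul, ← mul_assoc, h1, one_mul, h2]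

/-- On each finite subgroup averaging trivializes a power of `c`; `p` is a common exponent, with
witnesses `a` on `T` and `b` on `L`. Both work on `H`, so `a / b` is fixed by `H`, hence by `T`, and
`b` works on `T` too. -/
theorem exists_cocycle_pow_mul_eq {Δ N : Type*} [Group Δ] [CommGroup N] (ρ : Δ →* MulAut N)
    (c : Δ → N) (hc : ∀ h k, c (h * k) = c h * ρ h (c k)) {H T L : Subgroup Δ} [Finite T]
    [Finite L] (hHT : H ≤ T) (hHL : H ≤ L) (hTL : T ⊔ L = ⊤)
    (hfix : ∀ w, (∀ h ∈ H, ρ h w = w) → ∀ t ∈ T, ρ t w = w) :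
    ∃ p ≠ 0, ∃ b, ∀ δ, c δ ^ p * ρ δ b = b := by
  have key : ∀ K : Subgroup Δ, Finite K → ∃ v : N, ∀ k ∈ K,
      c k ^ Nat.card K * ρ k v = v := fun K _ => by
    have : Fintype K := Fintype.ofFinite K
    refine ⟨∏ k : K, c k, fun k hk => ?_⟩
    have := cocycle_pow_card_mul (ρ.comp K.subtype) (fun k => c k) (fun h k => hc h k) ⟨k, hk⟩
    rwa [← Nat.card_eq_fintype_card] at this
  obtain ⟨v, hv⟩ := key T inferInstance
  obtain ⟨u, hu⟩ := key L inferInstance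
  set p := Nat.card T * Nat.card L with hp
  have ha : ∀ t ∈ T, c t ^ p * ρ t (v ^ Nat.card L) = v ^ Nat.card L := by
    intro t ht
    rw [map_pow, hp, pow_mul, ← mul_pow, hv t ht]
  have hb : ∀ l ∈ L, c l ^ p * ρ l (u ^ Nat.card T) = u ^ Nat.card T := by
    intro l hl
    rw [map_pow, hp, mul_comm (Nat.card T), pow_mul, ← mul_pow, hu l hl]
  set a := v ^ Nat.card L
  set b := u ^ Nat.card T
  refine ⟨p, mul_ne_zero Nat.card_pos.ne' Nat.card_pos.ne', b, fun δ => ?_⟩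
  have hw : ∀ t ∈ T, ρ t (a / b) = a / b := hfix _ fun h hh => by
    have h1 := ha h (hHT hh)
    have h2 := hb h (hHL hh)
    rw [map_div]
    nth_rw 2 [← h1]
    nth_rw 2 [← h2]
    rw [mul_div_mul_left_eq_div]
  have hcp : ∀ h k, c (h * k) ^ p = c h ^ p * ρ h (c k ^ p) := fun h k => by
    rw [hc, mul_pow, map_pow]
  have : T ⊔ L ≤ cocycleStabilizer ρ (fun δ => c δ ^ p) hcp b := by
    refine sup_le (fun t ht => ?_) hb
    have h1 := ha t ht
    have h2 := hw t ht
    change c t ^ p * ρ t b = b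
    rw [map_div] at h2
    have h3 : ρ t b = b / a * ρ t a := by
      rw [div_eq_div_iff_mul_eq_mul] at h2
      rw [div_mul_eq_mul_div, eq_div_iff_mul_eq', mul_comm b, h2, mul_comm]
    rw [h3, mul_left_comm, h1, div_mul_cancel]
  exact this (hTL ▸ Subgroup.mem_top δ)

open scoped IsMulCommutative

/-- For an abelian normal subgroup `M` of finite index `q`, the map `m ↦ m ^ q` of `M` extends to
a crossed homomorphism on the whole group. -/
theorem exists_cocycle_of_finiteIndex {Δ : Type*} [Group Δ] (M : Subgroup Δ) [M.Normal]
    [IsMulCommutative M] [M.FiniteIndex] :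
    ∃ c : Δ → M, (∀ δ ε, c (δ * ε) = c δ * MulAut.conjNormal δ (c ε)) ∧
      ∀ m : M, c m = m ^ M.index := by
  classical
  have : Fintype (Δ ⧸ M) := M.fintypeQuotientOfFiniteIndex
  -- As for the transfer: `δ` permutes the coset representatives up to factors in `M`, and `c δ` is
  -- the product of these factors.
  have hd : ∀ (δ : Δ) (x : Δ ⧸ M), δ * x.out * ((δ : Δ ⧸ M) * x).out⁻¹ ∈ M := fun δ x => by
    rw [← QuotientGroup.eq_one_iff]
    simp
  let d : Δ → Δ ⧸ M → M := fun δ x => ⟨_, hd δ x⟩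
  have hmul : ∀ δ ε x, d (δ * ε) x = d δ ((ε : Δ ⧸ M) * x) * MulAut.conjNormal δ (d ε x) := by
    intro δ ε x
    rw [mul_comm]
    apply Subtype.ext
    simp only [d, Subgroup.coe_mul, MulAut.conjNormal_apply, QuotientGroup.mk_mul]
    rw [mul_assoc (δ : Δ ⧸ M)]
    group
  refine ⟨fun δ => ∏ x, d δ x, fun δ ε => ?_, fun m => ?_⟩
  · simp only [hmul, Finset.prod_mul_distrib, map_prod]
    congr 1
    exact Equiv.prod_comp (Equiv.mulLeft (ε : Δ ⧸ M)) (d δ)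
  · have : ∀ x, d m x = m := fun x => by
      apply Subtype.ext
      have h1 : ((m : Δ) : Δ ⧸ M) = 1 := (QuotientGroup.eq_one_iff _).2 m.2
      simp only [d, h1, one_mul]
      group
    simp only [this, Finset.prod_const, Finset.card_univ]
    rw [M.index_eq_card, Nat.card_eq_fintype_card]

theorem finite_of_sup_eq_top {Δ : Type*} [Group Δ] (M : Subgroup Δ) [M.Normal]
    [IsMulCommutative M] [IsMulTorsionFree M] [M.FiniteIndex] {H T L : Subgroup Δ} [Finite T]
    [Finite L] (hHT : H ≤ T) (hHL : H ≤ L) (hTL : T ⊔ L = ⊤)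
    (hfix : ∀ w ∈ M, (∀ h ∈ H, h * w * h⁻¹ = w) → ∀ t ∈ T, t * w * t⁻¹ = w) : Finite Δ := by
  obtain ⟨c, hc, hcM⟩ := exists_cocycle_of_finiteIndex M
  obtain ⟨p, hp0, b, hb⟩ := exists_cocycle_pow_mul_eq MulAut.conjNormal c hc hHT hHL hTL
    fun w hw t ht => Subtype.ext (hfix w w.2 (fun h hh => congrArg Subtype.val (hw h hh)) t ht)
  have hbot : M = ⊥ := by
    rw [Subgroup.eq_bot_iff_forall]
    intro m hm
    have h1 := hb m
    have h2 : MulAut.conjNormal (H := M) m b = b := by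
      apply Subtype.ext
      rw [MulAut.conjNormal_apply]
      have := congrArg Subtype.val (mul_comm (⟨m, hm⟩ : M) b)
      simp only [Subgroup.coe_mul] at this
      rw [this, mul_inv_cancel_right]
    rw [h2, mul_eq_right, hcM ⟨m, hm⟩, ← pow_mul,
      pow_eq_one_iff_left (mul_ne_zero Subgroup.FiniteIndex.index_ne_zero hp0)] at h1
    exact congrArg Subtype.val h1
  have h1 : M.index ≠ 0 := Subgroup.FiniteIndex.index_ne_zero
  rw [hbot, Subgroup.index_bot] at h1
  exact Nat.finite_of_card_ne_zero h1

end Cocycle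

/-! ### Lifting finiteness from a quotient -/

section Ascend

variable {Γ Γ' : Type*} [Group Γ] [Group Γ']

theorem finite_of_finite_map_of_finite_ker (f : Γ →* Γ') [Finite f.ker] (Δ : Subgroup Γ)
    [Finite (Δ.map f)] : Finite Δ := by
  refine (MonoidHom.finite_iff_finite_ker_range (f.comp Δ.subtype)).2 ⟨?_, ?_⟩
  · refine Finite.of_injective (fun x : (f.comp Δ.subtype).ker => (⟨x.1.1, x.2⟩ : f.ker)) ?_
    intro x y h
    exact Subtype.ext (Subtype.ext (congrArg (fun z : f.ker => (z : Γ)) h))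
  · rw [MonoidHom.range_comp, Subgroup.range_subtype]
    infer_instance

theorem finite_sup_of_finite_map_of_torsionFree (f : Γ →* Γ') [IsMulCommutative f.ker]
    [IsMulTorsionFree f.ker] {H T L : Subgroup Γ} [Finite T] [Finite L] (hHT : H ≤ T)
    (hHL : H ≤ L) (hindex : (Subgroup.centralizer (T : Set Γ)).IsFiniteRelIndex
      (Subgroup.centralizer (H : Set Γ))) [Finite ((T ⊔ L).map f)] :
    Finite (T ⊔ L : Subgroup Γ) := by
  set Δ := T ⊔ L with hΔ
  have hT : T ≤ Δ := le_sup_left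
  have hL : L ≤ Δ := le_sup_right
  let M : Subgroup Δ := f.ker.subgroupOf Δ
  let ι : M →* f.ker := ((Δ.subtype.comp M.subtype).codRestrict f.ker fun x => x.2)
  have hι : Function.Injective ι := fun x y h =>
    Subtype.ext (Subtype.ext (congrArg (fun z : f.ker => (z : Γ)) h))
  have : IsMulCommutative M := ⟨⟨fun x y => hι (by rw [map_mul, map_mul, mul_comm'])⟩⟩
  have : IsMulTorsionFree M := hι.isMulTorsionFree ι
  have : M.FiniteIndex := by
    have h : (f.comp Δ.subtype).ker = M := rfl
    refine ⟨?_⟩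
    rw [← h, Subgroup.index_ker, MonoidHom.range_comp, Subgroup.range_subtype]
    exact Nat.card_pos.ne'
  have : Finite (T.subgroupOf Δ) := (Subgroup.subgroupOfEquivOfLe hT).toEquiv.finite_iff.2 ‹_›
  have : Finite (L.subgroupOf Δ) := (Subgroup.subgroupOfEquivOfLe hL).toEquiv.finite_iff.2 ‹_›
  refine finite_of_sup_eq_top M (H := H.subgroupOf Δ) (T := T.subgroupOf Δ) (L := L.subgroupOf Δ)
    (Subgroup.comap_mono hHT) (Subgroup.comap_mono hHL) ?_ fun w hwM hwH t ht => ?_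
  · rw [← Subgroup.subgroupOf_sup hT hL, Subgroup.subgroupOf_self]
  · have hw : (w : Γ) ∈ Subgroup.centralizer (H : Set Γ) := by
      rw [Subgroup.mem_centralizer_iff]
      intro h hh
      have := congrArg Subtype.val (hwH ⟨h, hT (hHT hh)⟩ hh)
      exact mul_inv_eq_iff_eq_mul.1 this
    -- A power of `w` lies in the centralizer of `T`. Conjugating by `t` thus fixes `w ^ k`, and
    -- roots in `M` are unique, so it fixes `w`.
    obtain ⟨k, hk, -, hkT⟩ := Subgroup.exists_pow_mem_of_relIndex_ne_zero
      hindex.relIndex_ne_zero hw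
    rw [Subgroup.mem_inf, Subgroup.mem_centralizer_iff] at hkT
    have h1 : (⟨t * w * t⁻¹, Subgroup.Normal.conj_mem inferInstance w hwM t⟩ : M) ^ k =
        (⟨w, hwM⟩ : M) ^ k := by
      apply Subtype.ext
      apply Subtype.ext
      simp only [SubmonoidClass.mk_pow, conj_pow]
      have := hkT.1 t ht
      simp only [Subgroup.coe_mul, Subgroup.coe_pow, Subgroup.coe_inv]
      rw [this, mul_inv_cancel_right]
    exact congrArg Subtype.val (IsMulTorsionFree.pow_left_injective hk.ne' h1)

end Ascend

/-! ### Passing the centralizer condition to a quotient -/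

section Descend

open scoped IsMulCommutative

variable {Γ Γ' : Type*} [Group Γ] [Group Γ']

theorem cocycle_eq_mul_coboundary {K N : Type*} [Group K] [Fintype K] [CommGroup N]
    [IsMulTorsionFree N] (ρ : K →* MulAut N) (c c' : K → N)
    (hc : ∀ h k, c (h * k) = c h * ρ h (c k)) (hc' : ∀ h k, c' (h * k) = c' h * ρ h (c' k))
    {n : N} (hn : (∏ k, c' k) * n ^ Fintype.card K = ∏ k, c k) (h : K) :
    c h = n * c' h * (ρ h n)⁻¹ := by
  have h1 := cocycle_pow_card_mul ρ c hc h
  have h2 := cocycle_pow_card_mul ρ c' hc' h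
  rw [← hn, map_mul, map_pow] at h1
  apply IsMulTorsionFree.pow_left_injective (Fintype.card_ne_zero (α := K))
  simp only [mul_pow, inv_pow]
  rw [eq_mul_inv_iff_mul_eq]
  refine mul_right_cancel (b := ρ h (∏ k, c' k)) ?_
  rw [mul_assoc, mul_assoc, h2, mul_comm (_ ^ _) (ρ h (∏ k, c' k)), h1, mul_comm]

/-- Finiteness of `H¹(K, N)`: by averaging and uniqueness of roots, the class of `c` is determined
by `∏ h, c h` modulo `|K|`-th powers. -/
theorem exists_finite_cocycle_classes {K : Type*} {N : Type*} [Group K] [Finite K] [CommGroup N]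
    [IsMulTorsionFree N] (ρ : K →* MulAut N)
    (hfin : ∀ m ≠ 0, (powMonoidHom m : N →* N).range.FiniteIndex) :
    ∃ (X : Setoid N) (_ : Finite (Quotient X)) (s : (K → N) → Quotient X), ∀ c c' : K → N,
      (∀ h k, c (h * k) = c h * ρ h (c k)) → (∀ h k, c' (h * k) = c' h * ρ h (c' k)) →
      s c = s c' → ∃ n, ∀ h, c h = n * c' h * (ρ h n)⁻¹ := by
  have : Fintype K := Fintype.ofFinite K
  have := hfin _ (Fintype.card_ne_zero (α := K))
  refine ⟨QuotientGroup.leftRel (powMonoidHom (Fintype.card K) : N →* N).range,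
    inferInstanceAs (Finite (N ⧸ (powMonoidHom (Fintype.card K) : N →* N).range)),
    fun c => Quotient.mk _ (∏ h, c h),
    fun c c' hc hc' hcc' => ?_⟩
  obtain ⟨n, hn⟩ := QuotientGroup.eq.1 hcc'.symm
  exact ⟨n, cocycle_eq_mul_coboundary ρ c c' hc hc' (eq_inv_mul_iff_mul_eq.1 hn)⟩

theorem relIndex_ne_zero_of_finite_of_separates {X : Type*} [Finite X] (K D : Subgroup Γ)
    (φ : D → X) (h : ∀ g g' : D, φ g = φ g' → (g : Γ)⁻¹ * g' ∈ K) : K.relIndex D ≠ 0 := by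
  rw [Subgroup.relIndex, Subgroup.index_ne_zero_iff_finite]
  refine Finite.of_injective (fun x : D ⧸ K.subgroupOf D => φ x.out) fun x y hxy => ?_
  rw [← QuotientGroup.out_eq' x, ← QuotientGroup.out_eq' y, QuotientGroup.eq]
  exact h _ _ hxy

theorem commutator_mem_ker (f : Γ →* Γ') {H : Subgroup Γ} {g h : Γ}
    (hg : g ∈ (Subgroup.centralizer (H.map f : Set Γ')).comap f) (hh : h ∈ H) :
    g * h * g⁻¹ * h⁻¹ ∈ f.ker := by
  have := Subgroup.mem_centralizer_iff.1 (Subgroup.mem_comap.1 hg) (f h)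
    (Subgroup.mem_map_of_mem f hh)
  rw [MonoidHom.mem_ker, map_mul, map_mul, map_mul, map_inv, map_inv, ← this]
  group

theorem mem_centralizer_of_conj_eq {H : Subgroup Γ} {x y : Γ}
    (h : ∀ k ∈ H, x * k * x⁻¹ = y * k * y⁻¹) : x⁻¹ * y ∈ Subgroup.centralizer (H : Set Γ) := by
  rw [Subgroup.mem_centralizer_iff]
  intro k hk
  have := h k hk
  calc k * (x⁻¹ * y) = x⁻¹ * (x * k * x⁻¹) * y := by group
    _ = x⁻¹ * y * k := by rw [this]; group

theorem relIndex_centralizer_sup_ker_of_finite_ker (f : Γ →* Γ') [Finite f.ker] (H : Subgroup Γ)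
    [Finite H] : (Subgroup.centralizer (H : Set Γ) ⊔ f.ker).relIndex
      ((Subgroup.centralizer (H.map f : Set Γ')).comap f) ≠ 0 := by
  refine relIndex_ne_zero_of_finite_of_separates (X := H → f.ker) _ _
    (fun g h => ⟨_, commutator_mem_ker f g.2 h.2⟩) fun g g' hgg' => ?_
  refine (le_sup_left : _ ≤ _ ⊔ f.ker) (mem_centralizer_of_conj_eq fun k hk => ?_)
  have := congrArg Subtype.val (congrFun hgg' ⟨k, hk⟩)
  exact mul_right_cancel this

/-- Each `g` centralizing `H` modulo the kernel gives the cocycle `h ↦ g * h * g⁻¹ * h⁻¹`. If `g`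
and `g'` give cohomologous cocycles, then `g` and `n * g'` conjugate `H` alike for some `n` in the
kernel. -/
theorem relIndex_centralizer_sup_ker_of_torsionFree (f : Γ →* Γ') [IsMulCommutative f.ker]
    [IsMulTorsionFree f.ker] (hfin : ∀ m ≠ 0, (powMonoidHom m : f.ker →* f.ker).range.FiniteIndex)
    (H : Subgroup Γ) [Finite H] : (Subgroup.centralizer (H : Set Γ) ⊔ f.ker).relIndex
      ((Subgroup.centralizer (H.map f : Set Γ')).comap f) ≠ 0 := by
  let c : (Subgroup.centralizer (H.map f : Set Γ')).comap f → H → f.ker := fun g h =>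
    ⟨_, commutator_mem_ker f g.2 h.2⟩
  have hc : ∀ g h k, c g (h * k) = c g h * MulAut.conjNormal.comp H.subtype h (c g k) :=
    fun g h k => by
      apply Subtype.ext
      simp only [c, Subgroup.coe_mul, MonoidHom.comp_apply, Subgroup.subtype_apply,
        MulAut.conjNormal_apply]
      group
  obtain ⟨X, _, s, hs⟩ := exists_finite_cocycle_classes (MulAut.conjNormal.comp H.subtype) hfin
  refine relIndex_ne_zero_of_finite_of_separates _ _ (fun g => s (c g)) fun g g' hgg' => ?_
  obtain ⟨n, key⟩ := hs _ _ (hc g) (hc g') hgg'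
  have hz : (g : Γ)⁻¹ * (n * g') ∈ Subgroup.centralizer (H : Set Γ) := by
    refine mem_centralizer_of_conj_eq fun k hk => ?_
    have := congrArg Subtype.val (key ⟨k, hk⟩)
    simp only [c, Subgroup.coe_mul, MonoidHom.comp_apply, Subgroup.subtype_apply,
      MulAut.conjNormal_apply, Subgroup.coe_inv] at this
    calc (g : Γ) * k * (g : Γ)⁻¹ = (g * k * (g : Γ)⁻¹ * k⁻¹) * k := by group
      _ = _ := by rw [this]; group
  have : (g : Γ)⁻¹ * g' = ((g : Γ)⁻¹ * (n * g')) * ((g' : Γ)⁻¹ * (n : Γ)⁻¹ * g'⁻¹⁻¹) := by group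
  rw [this]
  refine mul_mem (le_sup_left (b := f.ker) hz) (le_sup_right (a := Subgroup.centralizer _) ?_)
  exact Subgroup.Normal.conj_mem inferInstance _ (inv_mem n.2) _

/-- The image of `C(T)` has finite index in that of `C(H)`, which has finite index in `C(f H)` by
`hH`; and the image of `C(T)` lies in `C(f T)`. -/
theorem isFiniteRelIndex_centralizer_map (f : Γ →* Γ') (hf : Function.Surjective f)
    {H T : Subgroup Γ}
    (hH : (Subgroup.centralizer (H : Set Γ) ⊔ f.ker).relIndex
      ((Subgroup.centralizer (H.map f : Set Γ')).comap f) ≠ 0)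
    (hindex : (Subgroup.centralizer (T : Set Γ)).IsFiniteRelIndex
      (Subgroup.centralizer (H : Set Γ))) :
    (Subgroup.centralizer (T.map f : Set Γ')).IsFiniteRelIndex
      (Subgroup.centralizer (H.map f : Set Γ')) := by
  have hle : (Subgroup.centralizer (T : Set Γ)).map f ≤ Subgroup.centralizer (T.map f : Set Γ') := by
    rintro _ ⟨g, hg, rfl⟩
    rw [Subgroup.mem_centralizer_iff]
    rintro _ ⟨t, ht, rfl⟩
    rw [← map_mul, ← map_mul, Subgroup.mem_centralizer_iff.1 hg t ht]
  have h1 : ((Subgroup.centralizer (T : Set Γ)).map f).relIndex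
      ((Subgroup.centralizer (H : Set Γ)).map f) ≠ 0 := by
    rw [← Subgroup.relIndex_comap, Subgroup.comap_map_eq]
    exact fun h => hindex.relIndex_ne_zero (Subgroup.relIndex_eq_zero_of_le_left le_sup_left h)
  have h2 : ((Subgroup.centralizer (H : Set Γ)).map f).relIndex
      (Subgroup.centralizer (H.map f : Set Γ')) ≠ 0 := by
    rw [← Subgroup.map_comap_eq_self_of_surjective hf (Subgroup.centralizer (H.map f : Set Γ')),
      ← Subgroup.relIndex_comap, Subgroup.comap_map_eq]
    exact hH
  have h3 := Subgroup.relIndex_ne_zero_trans h1 h2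
  refine ⟨fun h => h3 (Subgroup.relIndex_eq_zero_of_le_left hle h)⟩

end Descend

/-! ### Torsion-free abelian groups of finite rank -/

section FiniteRank

/-- An abelian group has finite torsion-free rank. -/
def HasFiniteRank (N : Type*) [CommGroup N] : Prop :=
  Module.rank ℤ (Additive N) < Cardinal.aleph0

theorem exists_le_linearEquiv_of_fg {M : Type*} [AddCommGroup M] [IsAddTorsionFree M]
    (hr : Module.rank ℤ M < Cardinal.aleph0) :
    ∃ n : ℕ, ∀ Λ : Submodule ℤ M, Λ.FG → ∃ k ≤ n, Nonempty (Λ ≃ₗ[ℤ] (Fin k → ℤ)) := by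
  obtain ⟨n, hn⟩ := Cardinal.lt_aleph0.1 hr
  refine ⟨n, fun Λ hΛ => ?_⟩
  have : Module.Finite ℤ Λ := Module.Finite.iff_fg.2 hΛ
  have : Module.Free ℤ Λ := inferInstance
  refine ⟨Module.finrank ℤ Λ, ?_, ⟨(Module.finBasis ℤ Λ).equivFun⟩⟩
  have := Submodule.rank_le Λ
  rw [hn, ← Module.finrank_eq_rank] at this
  exact_mod_cast this

/-- Representatives of `m ^ n + 1` classes would span a lattice of rank `k ≤ n`, which has only `m ^
k` classes modulo `m`. -/
theorem finiteIndex_range_powMonoidHom {N : Type*} [CommGroup N] [IsMulTorsionFree N]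
    (hr : HasFiniteRank N) {m : ℕ} (hm : m ≠ 0) :
    (powMonoidHom m : N →* N).range.FiniteIndex := by
  classical
  obtain ⟨n, hn⟩ := exists_le_linearEquiv_of_fg hr
  set Q := N ⧸ (powMonoidHom m : N →* N).range
  have : NeZero m := ⟨hm⟩
  suffices h : Finite Q from Subgroup.finiteIndex_iff_finite_quotient.2 h
  by_contra hinf
  rw [not_finite_iff_infinite] at hinf
  obtain ⟨F, hF⟩ := Infinite.exists_subset_card_eq Q (m ^ n + 1)
  let lift : Q → Additive N := fun q => Additive.ofMul q.out
  obtain ⟨k, hk, ⟨e⟩⟩ := hn (Submodule.span ℤ (lift '' F))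
    (Submodule.fg_span (F.finite_toSet.image _))
  have hmem : ∀ q ∈ F, lift q ∈ Submodule.span ℤ (lift '' F) := fun q hq =>
    Submodule.subset_span ⟨q, hq, rfl⟩
  let φ : F → (Fin k → ZMod m) := fun q i => (e ⟨lift q, hmem q q.2⟩ i : ZMod m)
  have hφ : Function.Injective φ := by
    intro q q' hqq'
    have h1 : ∀ i, ∃ z : ℤ, e ⟨lift q', hmem q' q'.2⟩ i - e ⟨lift q, hmem q q.2⟩ i = m * z :=
      fun i => (ZMod.intCast_eq_intCast_iff_dvd_sub _ _ _).1 (congrFun hqq' i)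
    choose z hz using h1
    have h2 : (⟨lift q', hmem q' q'.2⟩ : Submodule.span ℤ (lift '' F)) - ⟨lift q, hmem q q.2⟩ =
        m • e.symm z := by
      apply e.injective
      rw [map_sub, map_nsmul, e.apply_symm_apply]
      ext i
      simp [hz]
    have h3 : lift q' - lift q = m • (e.symm z : Additive N) := congrArg Subtype.val h2
    apply Subtype.ext
    rw [← QuotientGroup.out_eq' (q : Q), ← QuotientGroup.out_eq' (q' : Q), QuotientGroup.eq]
    refine ⟨(e.symm z : Additive N).toMul, ?_⟩
    rw [powMonoidHom_apply, ← toMul_nsmul, ← h3, inv_mul_eq_div]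
    rfl
  have := Fintype.card_le_of_injective φ hφ
  simp only [Fintype.card_coe, hF, Fintype.card_fun, ZMod.card, Fintype.card_fin] at this
  have h4 : m ^ k ≤ m ^ n := Nat.pow_le_pow_right (Nat.pos_of_ne_zero hm) hk
  omega

end FiniteRank

/-! ### Minkowski's bound for finite groups of automorphisms -/

section Minkowski

theorem exists_one_add_pow_eq {R : Type*} [Ring R] (x : R) (p : ℕ) :
    ∃ y : R, (1 + x) ^ p = 1 + (p : R) * x + x * x * y := by
  induction p with
  | zero => exact ⟨0, by simp⟩
  | succ p ih =>
    obtain ⟨y, hy⟩ := ih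
    refine ⟨(p : R) + y * (1 + x), ?_⟩
    rw [pow_succ, hy]
    have := (Nat.cast_commute p x).eq
    push_cast
    simp only [add_mul, mul_add, one_mul, mul_one, mul_assoc, this]
    abel

/-- Expand `a ^ p = 1` around `1` and cancel the power of `3`. For `p ≠ 3` this leaves `p * c`
divisible by `3`; for `p = 3` it leaves `c` plus multiples of `3`. With `2` in place of `3`, the
first step would fail at `p = 2`. -/
theorem three_pow_dvd_of_pow_prime_eq_one {R : Type*} [Ring R] [IsAddTorsionFree R] {a : R} {p : ℕ}
    (hp : p.Prime) (ha : a ^ p = 1) (h : ∃ c, a = 1 + 3 • c) (j : ℕ) :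
    ∃ c, a = 1 + 3 ^ (j + 1) • c := by
  induction j with
  | zero => simpa using h
  | succ j ih =>
    obtain ⟨c, hc⟩ := ih
    suffices ∃ d, c = 3 • d by
      obtain ⟨d, rfl⟩ := this
      exact ⟨d, by rw [hc, pow_succ 3 (j + 1), mul_smul]⟩
    by_cases hp3 : p = 3
    · subst hp3
      have h1 : 3 ^ (j + 2) • (c + 3 ^ (j + 1) • (c * c) + 3 ^ (2 * j + 1) • (c * c * c)) = 0 := by
        have : (1 + 3 ^ (j + 1) • c) ^ 3 - 1 =
          3 ^ (j + 2) • (c + 3 ^ (j + 1) • (c * c) + 3 ^ (2 * j + 1) • (c * c * c)) := by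
          have hx : ∀ x : R, (1 + x) ^ 3 - 1 = 3 • x + 3 • (x * x) + x * x * x := fun x => by
            noncomm_ring
          rw [hx]
          simp only [smul_add, smul_mul_assoc, mul_smul_comm, smul_smul]
          have e1 : 3 * 3 ^ (j + 1) = 3 ^ (j + 2) := by ring
          have e2 : 3 * (3 ^ (j + 1) * 3 ^ (j + 1)) = 3 ^ (j + 2) * 3 ^ (j + 1) := by ring
          have e3 : 3 ^ (j + 1) * (3 ^ (j + 1) * 3 ^ (j + 1)) = 3 ^ (j + 2) * 3 ^ (2 * j + 1) := by
            ring
          rw [e1, e2, e3]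
        rw [← this, ← hc, ha, sub_self]
      rw [nsmul_eq_zero_iff_right (by positivity)] at h1
      refine ⟨-(3 ^ j • (c * c) + 3 ^ (2 * j) • (c * c * c)), ?_⟩
      rw [add_assoc, add_eq_zero_iff_eq_neg] at h1
      refine h1.trans ?_
      rw [smul_neg, smul_add, smul_smul, smul_smul, pow_succ' 3 j, pow_succ' 3 (2 * j)]
    · obtain ⟨y, hy⟩ := exists_one_add_pow_eq (3 ^ (j + 1) • c) p
      rw [← hc, ha] at hy
      have h1 : 3 ^ (j + 1) • ((p : R) * c + 3 ^ (j + 1) • (c * c * y)) = 0 := by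
        have h2 : (p : R) * (3 ^ (j + 1) • c) + 3 ^ (j + 1) • c * 3 ^ (j + 1) • c * y = 0 := by
          rw [add_assoc] at hy
          exact (left_eq_add.1 hy)
        rw [← h2]
        simp only [smul_add, mul_smul_comm, smul_mul_assoc]
      rw [nsmul_eq_zero_iff_right (by positivity), add_eq_zero_iff_eq_neg] at h1
      have hcop : IsCoprime (p : ℤ) 3 := by
        have := (Nat.coprime_primes hp Nat.prime_three).2 hp3
        exact_mod_cast Nat.isCoprime_iff_coprime.2 this
      obtain ⟨u, v, huv⟩ := hcop
      refine ⟨v • c - u • 3 ^ j • (c * c * y), ?_⟩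
      have h3 : c = u • ((p : R) * c) + (3 : ℕ) • v • c := by
        conv_lhs => rw [← one_smul ℤ c, ← huv]
        rw [add_smul, mul_smul, mul_smul, natCast_zsmul, nsmul_eq_mul, smul_comm v]
        norm_cast
      refine h3.trans ?_
      rw [h1, pow_succ', mul_smul, smul_sub, smul_neg, smul_comm u (3 : ℕ), sub_eq_add_neg, add_comm]

theorem Matrix.eq_one_of_pow_prime_eq_one {k : ℕ} {A : Matrix (Fin k) (Fin k) ℤ} {p : ℕ}
    (hp : p.Prime) (hA : A ^ p = 1) (h : (Int.castRingHom (ZMod 3)).mapMatrix A = 1) : A = 1 := by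
  have h0 : ∃ C, A = 1 + 3 • C := by
    have : ∀ i j, ∃ z : ℤ, A i j - (1 : Matrix (Fin k) (Fin k) ℤ) i j = (3 : ℕ) * z := fun i j => by
      rw [← map_one ((Int.castRingHom (ZMod 3)).mapMatrix (m := Fin k))] at h
      exact (ZMod.intCast_eq_intCast_iff_dvd_sub _ _ _).1 (congrFun (congrFun h i) j).symm
    choose z hz using this
    refine ⟨Matrix.of z, ?_⟩
    ext i j
    have := hz i j
    rw [Matrix.add_apply, Matrix.smul_apply, Matrix.of_apply, nsmul_eq_mul, ← this]
    ring
  rw [← sub_eq_zero]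
  ext i j
  by_contra hne
  rw [Matrix.zero_apply] at hne
  have : IsAddTorsionFree (Matrix (Fin k) (Fin k) ℤ) :=
    inferInstanceAs (IsAddTorsionFree (Fin k → Fin k → ℤ))
  -- The exponent is chosen so that the power of `3` exceeds the absolute value of the nonzero entry
  -- it divides.
  obtain ⟨C, hC⟩ := three_pow_dvd_of_pow_prime_eq_one hp hA h0 ((A - 1) i j).natAbs
  have h1 : (3 : ℤ) ^ (((A - 1) i j).natAbs + 1) ∣ (A - 1) i j := by
    refine ⟨C i j, ?_⟩
    conv_lhs => rw [hC, add_sub_cancel_left]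
    simp
  have h2 := Int.natAbs_le_of_dvd_ne_zero h1 hne
  rw [Int.natAbs_pow] at h2
  have h3 := Nat.lt_pow_self (n := ((A - 1) i j).natAbs + 1) (show 1 < 3 by norm_num)
  change 3 ^ _ ≤ _ at h2
  omega

/-- **Minkowski's lemma**: an integral matrix of finite order congruent to `1` modulo `3` is
trivial. -/
theorem Matrix.eq_one_of_isOfFinOrder {k : ℕ} {A : Matrix (Fin k) (Fin k) ℤ}
    (hA : IsOfFinOrder A) (h : (Int.castRingHom (ZMod 3)).mapMatrix A = 1) : A = 1 := by
  by_contra hne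
  have hm : orderOf A ≠ 1 := fun h1 => hne (orderOf_eq_one_iff.1 h1)
  have hp := Nat.minFac_prime hm
  set p := (orderOf A).minFac with hpdef
  have hdvd : orderOf A / p * p = orderOf A := Nat.div_mul_cancel (Nat.minFac_dvd _)
  have h1 : A ^ (orderOf A / p) = 1 := by
    refine Matrix.eq_one_of_pow_prime_eq_one hp ?_ ?_
    · rw [← pow_mul, hdvd, pow_orderOf_eq_one]
    · rw [map_pow, h, one_pow]
  have h2 := hA.orderOf_pos
  exact pow_ne_one_of_lt_orderOf (Nat.div_pos (Nat.minFac_le h2) hp.pos).ne'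
    (Nat.div_lt_self h2 hp.one_lt) h1

/-- An automorphism of an abelian group as a linear map over the integers. -/
def MulAut.toIntLinearMap {N : Type*} [CommGroup N] : MulAut N →* Module.End ℤ (Additive N) where
  toFun f := (MulEquiv.toAdditive f).toAddMonoidHom.toIntLinearMap
  map_one' := rfl
  map_mul' _ _ := rfl

/-- The action of a group of automorphisms on an invariant subgroup. -/
def MulAut.restrictSpan {N : Type*} [CommGroup N] {F : Subgroup (MulAut N)}
    {Λ : Submodule ℤ (Additive N)} (h : ∀ f ∈ F, ∀ x ∈ Λ, MulAut.toIntLinearMap f x ∈ Λ) :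
    F →* Module.End ℤ Λ where
  toFun f := (MulAut.toIntLinearMap (f : MulAut N)).restrict (h f f.2)
  map_one' := rfl
  map_mul' _ _ := rfl

/-- For each nontrivial `f` in `F` pick an element it moves. The orbits of these span an
`F`-invariant lattice of rank at most `n` on which `F` is faithful, and reduction modulo `3` is
injective on `F`. -/
theorem exists_card_le_of_finite_subgroup_mulAut {N : Type*} [CommGroup N] [IsMulTorsionFree N]
    (hr : HasFiniteRank N) : ∃ C : ℕ, ∀ F : Subgroup (MulAut N), Finite F → Nat.card F ≤ C := by
  classical
  obtain ⟨n, hn⟩ := exists_le_linearEquiv_of_fg hr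
  refine ⟨3 ^ (n * n), fun F _ => ?_⟩
  have : ∀ f : F, ∃ x : N, (f : MulAut N) x = x → f = 1 := fun f => by
    by_contra! H
    exact (H 1).2 (Subtype.ext (MulEquiv.ext fun x => (H x).1))
  choose x hx using this
  let S : Set (Additive N) :=
    Set.range fun t : F × F => MulAut.toIntLinearMap t.1 (Additive.ofMul (x t.2))
  have hS : S.Finite := Set.finite_range _
  have hinv : ∀ f ∈ F, ∀ y ∈ Submodule.span ℤ S,
      MulAut.toIntLinearMap f y ∈ Submodule.span ℤ S := by
    intro f hf y hy
    have : Submodule.span ℤ S ≤ (Submodule.span ℤ S).comap (MulAut.toIntLinearMap f) := by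
      rw [Submodule.span_le]
      rintro _ ⟨⟨g, h⟩, rfl⟩
      refine Submodule.subset_span ⟨(⟨f, hf⟩ * g, h), ?_⟩
      rfl
    exact this hy
  obtain ⟨k, hk, ⟨e⟩⟩ := hn _ (Submodule.fg_span hS)
  let θ : F →* Matrix (Fin k) (Fin k) ℤ :=
    ((LinearMap.toMatrixAlgEquiv' : _ ≃ₐ[ℤ] Matrix (Fin k) (Fin k) ℤ).toMonoidHom.comp
      (e.conjRingEquiv : Module.End ℤ _ →* Module.End ℤ (Fin k → ℤ))).comp
      (MulAut.restrictSpan hinv)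
  have hθ : ∀ f, θ f = 1 → f = 1 := by
    intro f hf
    have h1 : MulAut.restrictSpan hinv f = 1 := by
      apply e.conjRingEquiv.injective
      apply (LinearMap.toMatrixAlgEquiv' : _ ≃ₐ[ℤ] Matrix (Fin k) (Fin k) ℤ).injective
      rw [map_one, map_one]
      exact hf
    have h2 : Additive.ofMul (x f) ∈ Submodule.span ℤ S := Submodule.subset_span ⟨(1, f), rfl⟩
    apply hx
    exact congrArg Subtype.val (LinearMap.congr_fun h1 ⟨_, h2⟩)
  let ψ : F →* Matrix (Fin k) (Fin k) (ZMod 3) :=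
    ((Int.castRingHom (ZMod 3)).mapMatrix (m := Fin k)).toMonoidHom.comp θ
  have hψ : Function.Injective ψ := by
    refine (injective_iff_map_eq_one ψ).2 fun f hf => hθ f ?_
    exact Matrix.eq_one_of_isOfFinOrder (θ.isOfFinOrder (isOfFinOrder_of_finite f)) hf
  have h1 := Nat.card_le_card_of_injective ψ hψ
  have h2 : Nat.card (Matrix (Fin k) (Fin k) (ZMod 3)) = 3 ^ (k * k) := by
    simp [Matrix, Nat.card_eq_fintype_card, pow_mul]
  rw [h2] at h1
  exact h1.trans (Nat.pow_le_pow_right (by norm_num) (Nat.mul_le_mul hk hk))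

end Minkowski

/-! ### Torsion solvable groups -/

section TorsionSolvable

/-- Inductively, each derived term has finite index, hence is finitely generated, and its torsion
abelianization is finite. -/
theorem finite_of_fg_of_isSolvable_of_torsion {G : Type*} [Group G] [hs : Group.IsSolvable G]
    [hfg : Group.FG G] (ht : ∀ g : G, IsOfFinOrder g) : Finite G := by
  have key : ∀ i, (derivedSeries G i).FiniteIndex := fun i => by
    induction i with
    | zero => rw [derivedSeries_zero]; infer_instance
    | succ i ih =>
      have : Finite (Abelianization (derivedSeries G i)) := by
        have : Group.FG (Abelianization (derivedSeries G i)) :=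
          Group.fg_of_surjective (QuotientGroup.mk'_surjective (commutator (derivedSeries G i)))
        refine CommGroup.finite_of_fg_isMulTorsion (Abelianization (derivedSeries G i)) ?_
        intro x
        induction x using QuotientGroup.induction_on with
        | H g =>
          exact (Abelianization.of).isOfFinOrder (Submonoid.isOfFinOrder_coe.1 (ht g))
      have h1 : (commutator (derivedSeries G i)).index ≠ 0 :=
        Subgroup.index_ne_zero_iff_finite.2 this
      refine ⟨?_⟩
      rw [derivedSeries_succ, ← Subgroup.map_subtype_commutator, Subgroup.index_map_subtype]
      exact mul_ne_zero h1 ih.index_ne_zero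
  obtain ⟨n, hn⟩ := hs
  have := (key n).index_ne_zero
  rw [hn, Subgroup.index_bot] at this
  exact Nat.finite_of_card_ne_zero this

theorem finite_of_torsion_of_isSolvable_of_card_le {G : Type*} [Group G] [Group.IsSolvable G]
    (ht : ∀ g : G, IsOfFinOrder g) {C : ℕ} (hC : ∀ F : Subgroup G, Finite F → Nat.card F ≤ C) :
    Finite G := by
  by_contra hinf
  rw [not_finite_iff_infinite] at hinf
  obtain ⟨S, hS⟩ := Infinite.exists_subset_card_eq G (C + 1)
  have : Group.FG (Subgroup.closure (S : Set G)) := inferInstance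
  have hfin : Finite (Subgroup.closure (S : Set G)) :=
    finite_of_fg_of_isSolvable_of_torsion fun g => Submonoid.isOfFinOrder_coe.1 (ht g)
  have h1 := hC _ hfin
  have h2 : S.card ≤ Nat.card (Subgroup.closure (S : Set G)) := by
    rw [← Fintype.card_coe, ← Nat.card_eq_fintype_card]
    exact Nat.card_le_card_of_injective (fun x : S => ⟨x, Subgroup.subset_closure x.2⟩)
      fun x y h => Subtype.ext (congrArg (fun z : Subgroup.closure (S : Set G) => (z : G)) h)
  omega

end TorsionSolvable

/-! ### Finite rank of abelian sections -/

section AbelianFiniteRank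

theorem HasFiniteRank.of_surjective {N N' : Type u} [CommGroup N] [CommGroup N'] (f : N →* N')
    (hf : Function.Surjective f) (h : HasFiniteRank N) : HasFiniteRank N' :=
  (LinearMap.rank_le_of_surjective (MonoidHom.toAdditive f).toIntLinearMap hf).trans_lt h

theorem HasFiniteRank.of_injective {N N' : Type u} [CommGroup N] [CommGroup N'] (f : N →* N')
    (hf : Function.Injective f) (h : HasFiniteRank N') : HasFiniteRank N :=
  (LinearMap.rank_le_of_injective (MonoidHom.toAdditive f).toIntLinearMap hf).trans_lt h

theorem HasFiniteRank.of_finite (N : Type u) [CommGroup N] [Finite N] : HasFiniteRank N :=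
  (rank_le_card ℤ (Additive N)).trans_lt (Cardinal.lt_aleph0_of_finite _)

theorem HasFiniteRank.of_exact {A N N' : Type u} [CommGroup A] [CommGroup N] [CommGroup N']
    (g : A →* N) (f : N →* N') (hfg : f.ker ≤ g.range) (hA : HasFiniteRank A)
    (hN' : HasFiniteRank N') : HasFiniteRank N := by
  let f' := (MonoidHom.toAdditive f).toIntLinearMap
  let g' := (MonoidHom.toAdditive g).toIntLinearMap
  have h1 := rank_quotient_add_rank_of_isDomain f'.ker
  have h2 : Module.rank ℤ f'.ker ≤ Module.rank ℤ (Additive A) :=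
    (Submodule.rank_mono (show f'.ker ≤ g'.range from fun x hx => hfg hx)).trans (rank_range_le g')
  have h3 : Module.rank ℤ (Additive N ⧸ f'.ker) ≤ Module.rank ℤ (Additive N') :=
    f'.quotKerEquivRange.rank_eq.trans_le (Submodule.rank_le _)
  unfold HasFiniteRank
  rw [← h1]
  exact Cardinal.add_lt_aleph0 (h3.trans_lt hN') (h2.trans_lt hA)

/-- Every abelian section of the group `Γ` has finite torsion-free rank. -/
def HasFiniteAbelianSectionRank (Γ : Type u) [Group Γ] : Prop :=
  ∀ K : Subgroup Γ, HasFiniteRank (Abelianization K)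

theorem Abelianization.map_surjective {G G' : Type*} [Group G] [Group G'] {f : G →* G'}
    (hf : Function.Surjective f) : Function.Surjective (Abelianization.map f) := by
  intro x
  obtain ⟨y, rfl⟩ := QuotientGroup.mk_surjective x
  obtain ⟨z, rfl⟩ := hf y
  exact ⟨Abelianization.of z, Abelianization.map_of f z⟩

variable {Γ Γ' : Type u} [Group Γ] [Group Γ']

theorem HasFiniteAbelianSectionRank.of_injective (f : Γ →* Γ') (hf : Function.Injective f)
    (h : HasFiniteAbelianSectionRank Γ') : HasFiniteAbelianSectionRank Γ := fun K =>
  (h (K.map f)).of_surjective (Abelianization.map (K.equivMapOfInjective f hf).symm.toMonoidHom)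
    (Abelianization.map_surjective (K.equivMapOfInjective f hf).symm.surjective)

theorem HasFiniteAbelianSectionRank.of_surjective (f : Γ →* Γ') (hf : Function.Surjective f)
    (h : HasFiniteAbelianSectionRank Γ) : HasFiniteAbelianSectionRank Γ' := fun K =>
  (h (K.comap f)).of_surjective (Abelianization.map (f.subgroupComap K))
    (Abelianization.map_surjective (f.subgroupComap_surjective_of_surjective K hf))

theorem HasFiniteAbelianSectionRank.of_finite (Γ : Type u) [Group Γ] [Finite Γ] :
    HasFiniteAbelianSectionRank Γ := fun K => by
  have : Finite (Abelianization K) := Quotient.finite _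
  exact HasFiniteRank.of_finite _

theorem HasFiniteAbelianSectionRank.of_hasFiniteRank {N : Type u} [CommGroup N]
    (h : HasFiniteRank N) : HasFiniteAbelianSectionRank N := fun K => by
  refine h.of_injective (Abelianization.lift K.subtype) ?_
  refine (injective_iff_map_eq_one _).2 fun x hx => ?_
  obtain ⟨y, rfl⟩ := QuotientGroup.mk_surjective x
  have : (y : N) = 1 := hx
  rw [OneMemClass.coe_eq_one] at this
  rw [this]
  rfl

theorem HasFiniteAbelianSectionRank.of_ker (f : Γ →* Γ')
    (h : HasFiniteAbelianSectionRank f.ker) (h' : HasFiniteAbelianSectionRank Γ') :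
    HasFiniteAbelianSectionRank Γ := fun K => by
  let g : K.subgroupOf f.ker →* K :=
    (f.ker.subtype.comp (K.subgroupOf f.ker).subtype).codRestrict K fun x => x.2
  refine HasFiniteRank.of_exact (Abelianization.map g) (Abelianization.map (f.subgroupMap K)) ?_
    (h _) (h' (K.map f))
  intro x hx
  obtain ⟨y, rfl⟩ := QuotientGroup.mk_surjective x
  have h1 : f.subgroupMap K y ∈ commutator (K.map f) :=
    (QuotientGroup.eq_one_iff _).1 hx
  have h2 : (commutator K).map (f.subgroupMap K) = commutator (K.map f) := by
    rw [commutator_def, commutator_def, Subgroup.map_commutator,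
      Subgroup.map_top_of_surjective _ (f.subgroupMap_surjective K)]
  rw [← h2] at h1
  -- Exactness of `(K ∩ ker f)^ab → K^ab → (f K)^ab` in the middle: dividing `y` by a product of
  -- commutators moves it into the kernel.
  obtain ⟨c, hc, hcy⟩ := h1
  have h3 : ((c⁻¹ * y : K) : Γ) ∈ f.ker := by
    have := congrArg Subtype.val hcy
    rw [MonoidHom.mem_ker, Subgroup.coe_mul, map_mul, Subgroup.coe_inv, map_inv]
    exact inv_mul_eq_one.2 this
  refine ⟨Abelianization.of ⟨⟨_, h3⟩, (c⁻¹ * y).2⟩, ?_⟩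
  rw [Abelianization.map_of]
  refine QuotientGroup.eq.2 ?_
  have : (g ⟨⟨_, h3⟩, (c⁻¹ * y).2⟩)⁻¹ * y = y⁻¹ * c * y := by
    apply Subtype.ext
    change ((c⁻¹ * y : K) : Γ)⁻¹ * y = _
    simp
  rw [this]
  have := Subgroup.Normal.conj_mem (inferInstance : (commutator K).Normal) c hc y⁻¹
  rwa [inv_inv] at this

theorem HasFiniteAbelianSectionRank.of_finiteIndex (S : Subgroup Γ) [S.FiniteIndex]
    (h : HasFiniteAbelianSectionRank S) : HasFiniteAbelianSectionRank Γ := by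
  refine of_ker (QuotientGroup.mk' S.normalCore) ?_ (of_finite _)
  rw [QuotientGroup.ker_mk']
  exact h.of_injective (Subgroup.inclusion S.normalCore_le) (Subgroup.inclusion_injective _)

theorem HasFiniteAbelianSectionRank.of_isSolvable [hs : Group.IsSolvable Γ]
    (h : ∀ i, HasFiniteRank (Abelianization (derivedSeries Γ i))) :
    HasFiniteAbelianSectionRank Γ := by
  obtain ⟨n, hn⟩ := hs
  have key : ∀ i ≤ n, HasFiniteAbelianSectionRank (derivedSeries Γ i) := by
    intro i hi
    induction hi using Nat.decreasingInduction with
    | self =>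
      rw [hn]
      exact of_finite _
    | of_succ i hi ih =>
      refine of_ker (Abelianization.of (G := derivedSeries Γ i)) ?_ (of_hasFiniteRank (h i))
      rw [Abelianization.ker_of]
      refine ih.of_injective (((derivedSeries Γ i).subtype.comp
        (commutator (derivedSeries Γ i)).subtype).codRestrict (derivedSeries Γ (i + 1)) ?_) ?_
      · intro x
        rw [derivedSeries_succ, ← Subgroup.map_subtype_commutator]
        exact ⟨x.1, x.2, rfl⟩
      · intro x y hxy
        exact Subtype.ext (Subtype.ext
          (congrArg (fun z : derivedSeries Γ (i + 1) => (z : Γ)) hxy))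
  have h0 := key 0 (Nat.zero_le n)
  rw [derivedSeries_zero] at h0
  exact h0.of_injective (Subgroup.topEquiv (G := Γ)).symm.toMonoidHom
    (Subgroup.topEquiv (G := Γ)).symm.injective

theorem HasFiniteHirschRank.hasFiniteAbelianSectionRank (h : HasFiniteHirschRank Γ) :
    HasFiniteAbelianSectionRank Γ := by
  obtain ⟨S, _, _, hr⟩ := h
  exact HasFiniteAbelianSectionRank.of_finiteIndex S
    (HasFiniteAbelianSectionRank.of_isSolvable fun i => (Cardinal.le_sum _ i).trans_lt hr)

open scoped IsMulCommutative in
theorem HasFiniteAbelianSectionRank.hasFiniteRank (h : HasFiniteAbelianSectionRank Γ)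
    (B : Subgroup Γ) [IsMulCommutative B] : HasFiniteRank B :=
  (h B).of_injective (Abelianization.equivOfComm (H := B)).toMonoidHom
    (Abelianization.equivOfComm (H := B)).injective

end AbelianFiniteRank

/-! ### The torsion radical -/

section TorsionRadical

variable {Γ : Type*} [Group Γ]

/-- The largest normal torsion subgroup. -/
def torsionRadical (Γ : Type*) [Group Γ] : Subgroup Γ :=
  sSup {N : Subgroup Γ | N.Normal ∧ ∀ x ∈ N, IsOfFinOrder x}

theorem le_torsionRadical {N : Subgroup Γ} (hN : N.Normal) (h : ∀ x ∈ N, IsOfFinOrder x) :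
    N ≤ torsionRadical Γ :=
  le_sSup (show N ∈ {N : Subgroup Γ | N.Normal ∧ ∀ x ∈ N, IsOfFinOrder x} from ⟨hN, h⟩)

/-- The join of two normal torsion subgroups is torsion, so the family is directed and its supremum
is its union. -/
theorem mem_torsionRadical {x : Γ} : x ∈ torsionRadical Γ ↔
    ∃ N : Subgroup Γ, (N.Normal ∧ ∀ x ∈ N, IsOfFinOrder x) ∧ x ∈ N := by
  have hne : {N : Subgroup Γ | N.Normal ∧ ∀ x ∈ N, IsOfFinOrder x}.Nonempty :=
    ⟨⊥, inferInstance, fun x hx => by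
      rw [Subgroup.mem_bot.1 hx]
      exact IsOfFinOrder.one⟩
  have hdir : DirectedOn (· ≤ ·) {N : Subgroup Γ | N.Normal ∧ ∀ x ∈ N, IsOfFinOrder x} := by
    rintro N ⟨hN, hNt⟩ M ⟨hM, hMt⟩
    refine ⟨N ⊔ M, ⟨inferInstance, fun x hx => ?_⟩, le_sup_left, le_sup_right⟩
    obtain ⟨k, hk, hxk⟩ : ∃ k, 0 < k ∧ x ^ k ∈ M := by
      obtain ⟨n, hn, m, hm, rfl⟩ := Subgroup.mem_sup_of_normal_right.1 hx
      obtain ⟨k, hk, hnk⟩ := isOfFinOrder_iff_pow_eq_one.1 (hNt n hn)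
      refine ⟨k, hk, ?_⟩
      rw [← QuotientGroup.eq_one_iff]
      have : (m : Γ ⧸ M) = 1 := (QuotientGroup.eq_one_iff m).2 hm
      rw [QuotientGroup.mk_pow, QuotientGroup.mk_mul, this, mul_one, ← QuotientGroup.mk_pow, hnk,
        QuotientGroup.mk_one]
    exact (isOfFinOrder_pow.1 (hMt _ hxk)).resolve_right hk.ne'
  exact Subgroup.mem_sSup_of_directedOn hne hdir

instance : (torsionRadical Γ).Normal := by
  refine ⟨fun x hx g => ?_⟩
  obtain ⟨N, hN, hxN⟩ := mem_torsionRadical.1 hx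
  exact mem_torsionRadical.2 ⟨N, hN, hN.1.conj_mem x hxN g⟩

theorem isOfFinOrder_of_mem_torsionRadical {x : Γ} (hx : x ∈ torsionRadical Γ) :
    IsOfFinOrder x := by
  obtain ⟨N, hN, hxN⟩ := mem_torsionRadical.1 hx
  exact hN.2 x hxN

theorem exists_pow_mem_of_mk_isOfFinOrder {A : Subgroup Γ} [A.Normal] {x : Γ}
    (h : IsOfFinOrder (x : Γ ⧸ A)) : ∃ k, 0 < k ∧ x ^ k ∈ A := by
  obtain ⟨k, hk, hxk⟩ := isOfFinOrder_iff_pow_eq_one.1 h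
  exact ⟨k, hk, (QuotientGroup.eq_one_iff _).1 hxk⟩

theorem isOfFinOrder_mk_of_pow_mem {A : Subgroup Γ} [A.Normal] {x : Γ}
    (h : ∃ k, 0 < k ∧ x ^ k ∈ A) : IsOfFinOrder (x : Γ ⧸ A) := by
  obtain ⟨k, hk, hxk⟩ := h
  exact isOfFinOrder_iff_pow_eq_one.2 ⟨k, hk, (QuotientGroup.eq_one_iff _).2 hxk⟩

theorem torsionRadical_quotient_eq_bot :
    torsionRadical (Γ ⧸ torsionRadical Γ) = ⊥ := by
  rw [Subgroup.eq_bot_iff_forall]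
  intro x hx
  obtain ⟨y, rfl⟩ := QuotientGroup.mk_surjective x
  have : (torsionRadical (Γ ⧸ torsionRadical Γ)).comap (QuotientGroup.mk' _) ≤ torsionRadical Γ := by
    refine le_torsionRadical inferInstance fun z hz => ?_
    obtain ⟨k, hk, hzk⟩ := exists_pow_mem_of_mk_isOfFinOrder (isOfFinOrder_of_mem_torsionRadical hz)
    exact (isOfFinOrder_pow.1 (isOfFinOrder_of_mem_torsionRadical hzk)).resolve_right hk.ne'
  exact (QuotientGroup.eq_one_iff _).2 (this hx)

/-- The radical meets the torsion-free subgroup `G` trivially, and `G` has finite index. -/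
theorem finite_torsionRadical_of_finiteIndex (G : Subgroup Γ) [G.FiniteIndex]
    (hG : ∀ g : G, IsOfFinOrder g → g = 1) : Finite (torsionRadical Γ) := by
  have h1 : G ⊓ torsionRadical Γ = ⊥ := by
    rw [Subgroup.eq_bot_iff_forall]
    intro x hx
    have := hG ⟨x, hx.1⟩ (Submonoid.isOfFinOrder_coe.1 (isOfFinOrder_of_mem_torsionRadical hx.2))
    exact congrArg Subtype.val this
  have h2 : G.relIndex (torsionRadical Γ) ≠ 0 :=
    (Subgroup.isFiniteRelIndex_of_finiteIndex).relIndex_ne_zero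
  rw [← Subgroup.inf_relIndex_right, h1, Subgroup.relIndex_bot_left] at h2
  exact Nat.finite_of_card_ne_zero h2

end TorsionRadical

/-! ### The torsion hull of an abelian normal subgroup -/

section TorsionHull

variable {Γ : Type*} [Group Γ] (A G : Subgroup Γ) [A.Normal]

/-- The largest normal subgroup which is torsion modulo `A`, among those which are contained in `G`
and centralize `A`. -/
def torsionHull : Subgroup Γ :=
  (torsionRadical (Γ ⧸ A)).comap (QuotientGroup.mk' A) ⊓ (Subgroup.centralizer (A : Set Γ) ⊓ G)

instance [G.Normal] : (torsionHull A G).Normal :=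
  inferInstanceAs (Subgroup.Normal (_ ⊓ (_ ⊓ _)))

variable {A G}

theorem exists_pow_mem_of_mem_torsionHull {x : Γ} (hx : x ∈ torsionHull A G) :
    ∃ k, 0 < k ∧ x ^ k ∈ A :=
  exists_pow_mem_of_mk_isOfFinOrder (isOfFinOrder_of_mem_torsionRadical hx.1)

theorem le_torsionHull {N : Subgroup Γ} [hN : N.Normal]
    (hNA : N ≤ Subgroup.centralizer (A : Set Γ)) (hNG : N ≤ G)
    (h : ∀ x ∈ N, ∃ k, 0 < k ∧ x ^ k ∈ A) : N ≤ torsionHull A G := by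
  refine le_inf ?_ (le_inf hNA hNG)
  rw [← Subgroup.map_le_iff_le_comap]
  refine le_torsionRadical (hN.map _ (QuotientGroup.mk'_surjective A)) ?_
  rintro _ ⟨x, hx, rfl⟩
  exact isOfFinOrder_mk_of_pow_mem (h x hx)

theorem self_le_torsionHull [IsMulCommutative A] (hAG : A ≤ G) : A ≤ torsionHull A G :=
  le_torsionHull (Subgroup.le_centralizer A) hAG fun x hx => ⟨1, one_pos, by simpa using hx⟩

/-- Two elements of the hull generate a group whose centre has finite index. -/
theorem finiteIndex_center_closure_pair [Group.IsSolvable G] {x y : Γ}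
    (hx : x ∈ torsionHull A G) (hy : y ∈ torsionHull A G) :
    (Subgroup.center (Subgroup.closure {x, y})).FiniteIndex := by
  set K := Subgroup.closure {x, y} with hK
  have hKle : K ≤ torsionHull A G := by
    rw [hK, Subgroup.closure_le]
    rintro z (rfl | rfl)
    · exact hx
    · exact hy
  have : Group.FG K := Group.closure_finite_fg _
  have : Group.IsSolvable K :=
    Group.isSolvable_of_isSolvable_injective
      (Subgroup.inclusion_injective (hKle.trans (inf_le_right.trans inf_le_right)))
  have : Finite (K ⧸ A.subgroupOf K) := by
    have : Group.FG (K ⧸ A.subgroupOf K) :=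
      Group.fg_of_surjective (QuotientGroup.mk'_surjective _)
    refine finite_of_fg_of_isSolvable_of_torsion fun g => ?_
    obtain ⟨z, rfl⟩ := QuotientGroup.mk_surjective g
    obtain ⟨k, hk, hzk⟩ := exists_pow_mem_of_mem_torsionHull (hKle z.2)
    exact isOfFinOrder_mk_of_pow_mem ⟨k, hk, hzk⟩
  have : (A.subgroupOf K).FiniteIndex := Subgroup.finiteIndex_of_finite_quotient
  -- The hull centralizes `A`, so `A ∩ K` is central in `K`.
  refine Subgroup.finiteIndex_of_le (H := A.subgroupOf K) fun a ha => ?_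
  rw [Subgroup.mem_center_iff]
  intro k
  have h1 := (hKle k.2).2.1
  exact Subtype.ext (Subgroup.mem_centralizer_iff.1 h1 a ha).symm

/-- Transfer to a centre of index `n` is `g ↦ g ^ n`, so this power map is a homomorphism with
central values. -/
theorem exists_pow_commute [Group.IsSolvable G] {x y : Γ}
    (hx : x ∈ torsionHull A G) (hy : y ∈ torsionHull A G) :
    ∃ n ≠ 0, Commute (x ^ n) (y ^ n) ∧ (x * y) ^ n = x ^ n * y ^ n := by
  have := finiteIndex_center_closure_pair hx hy
  have hxK : x ∈ Subgroup.closure {x, y} := Subgroup.subset_closure (by simp)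
  have hyK : y ∈ Subgroup.closure {x, y} := Subgroup.subset_closure (by simp)
  let φ := MonoidHom.transferCenterPow (Subgroup.closure {x, y})
  refine ⟨_, (Subgroup.FiniteIndex.index_ne_zero : (Subgroup.center
    (Subgroup.closure {x, y})).index ≠ 0), ?_, ?_⟩
  · have h1 := (φ ⟨x, hxK⟩).2
    rw [MonoidHom.transferCenterPow_apply, Subgroup.mem_center_iff] at h1
    exact (congrArg Subtype.val (h1 (⟨y, hyK⟩ ^ _))).symm
  · have h1 := congrArg Subtype.val (congrArg Subtype.val (map_mul φ ⟨x, hxK⟩ ⟨y, hyK⟩))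
    simp only [φ, Subgroup.coe_mul, MonoidHom.transferCenterPow_apply] at h1
    exact h1

variable [hG : G.Normal] [Group.IsSolvable G]

/-- By `exists_pow_commute` the torsion elements of the hull form a subgroup; it is normal, hence
inside the trivial radical. -/
theorem eq_one_of_mem_torsionHull (hrad : torsionRadical Γ = ⊥) {x : Γ} (hx : x ∈ torsionHull A G)
    (ht : IsOfFinOrder x) : x = 1 := by
  let T : Subgroup Γ :=
    { carrier := {x | x ∈ torsionHull A G ∧ IsOfFinOrder x}
      mul_mem' := fun {x y} hx hy => by
        refine ⟨mul_mem hx.1 hy.1, ?_⟩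
        obtain ⟨n, hn, hc, h⟩ := exists_pow_commute hx.1 hy.1
        refine ((isOfFinOrder_pow (n := n)).1 ?_).resolve_right hn
        rw [h]
        exact hc.isOfFinOrder_mul (isOfFinOrder_pow.2 (Or.inl hx.2))
          (isOfFinOrder_pow.2 (Or.inl hy.2))
      one_mem' := ⟨one_mem _, IsOfFinOrder.one⟩
      inv_mem' := fun {x} hx => ⟨inv_mem hx.1, hx.2.inv⟩ }
  have hT : T.Normal := ⟨fun x hx g => ⟨Subgroup.Normal.conj_mem inferInstance x hx.1 g, by
    rw [← MulAut.conj_apply]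
    exact (MulAut.conj g).toMonoidHom.isOfFinOrder hx.2⟩⟩
  have := le_torsionRadical hT fun x hx => hx.2
  rw [hrad] at this
  exact Subgroup.mem_bot.1 (this ⟨hx, ht⟩)

theorem isMulCommutative_torsionHull (hrad : torsionRadical Γ = ⊥) :
    IsMulCommutative (torsionHull A G) := by
  refine ⟨⟨fun x y => ?_⟩⟩
  have hc : (x * y * (x : Γ)⁻¹ * (y : Γ)⁻¹ : Γ) = 1 := by
    refine eq_one_of_mem_torsionHull (A := A) (G := G) hrad
      (mul_mem (mul_mem (mul_mem x.2 y.2) (inv_mem x.2)) (inv_mem y.2)) ?_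
    have := finiteIndex_center_closure_pair x.2 y.2
    have hxK : (x : Γ) ∈ Subgroup.closure {(x : Γ), (y : Γ)} := Subgroup.subset_closure (by simp)
    have hyK : (y : Γ) ∈ Subgroup.closure {(x : Γ), (y : Γ)} := Subgroup.subset_closure (by simp)
    let φ := MonoidHom.transferCenterPow (Subgroup.closure {(x : Γ), (y : Γ)})
    let a : Subgroup.closure {(x : Γ), (y : Γ)} := ⟨x, hxK⟩
    let b : Subgroup.closure {(x : Γ), (y : Γ)} := ⟨y, hyK⟩
    -- The transfer has commutative target, so a power of the commutator is trivial: the commutator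
    -- is a torsion element of the hull.
    have h1 : φ (a * b * a⁻¹ * b⁻¹) = 1 := by
      simp only [map_mul, map_inv]
      rw [mul_comm' (φ a) (φ b), mul_inv_cancel_right, mul_inv_cancel]
    have h2 := congrArg Subtype.val (congrArg Subtype.val h1)
    simp only [φ, MonoidHom.transferCenterPow_apply] at h2
    exact isOfFinOrder_iff_pow_eq_one.2 ⟨_,
      Nat.pos_of_ne_zero Subgroup.FiniteIndex.index_ne_zero, h2⟩
  apply Subtype.ext
  rw [mul_inv_eq_one, mul_inv_eq_iff_eq_mul] at hc
  exact hc

theorem isMulTorsionFree_torsionHull (hrad : torsionRadical Γ = ⊥) :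
    IsMulTorsionFree (torsionHull A G) := by
  have := isMulCommutative_torsionHull (A := A) (G := G) hrad
  refine ⟨fun n hn x y hxy => ?_⟩
  have hxy' : x ^ n = y ^ n := hxy
  have h1 : (x * y⁻¹) ^ n = 1 := by
    rw [(show Commute x y⁻¹ from mul_comm' _ _).mul_pow, hxy', inv_pow, mul_inv_cancel]
  have h2 : IsOfFinOrder ((x * y⁻¹ : torsionHull A G) : Γ) :=
    Submonoid.isOfFinOrder_coe.2 (isOfFinOrder_iff_pow_eq_one.2 ⟨n, Nat.pos_of_ne_zero hn, h1⟩)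
  have h3 := eq_one_of_mem_torsionHull hrad (x * y⁻¹).2 h2
  exact mul_inv_eq_one.1 (Subtype.ext h3)

end TorsionHull

/-! ### Induction on the derived length -/

section Main

open scoped IsMulCommutative

theorem finite_subgroup_map {G G' : Type*} [Group G] [Group G'] (f : G →* G') (K : Subgroup G)
    [Finite K] : Finite (K.map f) :=
  Finite.of_surjective _ (f.subgroupMap_surjective K)

theorem finite_of_torsion_isSolvable_mulAut {N : Type*} [CommGroup N] [IsMulTorsionFree N]
    (hr : HasFiniteRank N) (Q : Subgroup (MulAut N)) [Group.IsSolvable Q]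
    (ht : ∀ q ∈ Q, IsOfFinOrder q) : Finite Q := by
  obtain ⟨C, hC⟩ := exists_card_le_of_finite_subgroup_mulAut hr
  refine finite_of_torsion_of_isSolvable_of_card_le (C := C)
    (fun q => Submonoid.isOfFinOrder_coe.1 (ht q q.2)) fun F hF => ?_
  have h := hC (F.map Q.subtype) (finite_subgroup_map _ _)
  rwa [Nat.card_congr (F.equivMapOfInjective Q.subtype Q.subtype_injective).toEquiv.symm] at h

variable {Γ : Type u} [Group Γ]

/-- Let `M` be the preimage of the radical. The group `M ⊓ G` is solvable and torsion modulo `B`,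
which acts trivially on itself, so its image in `MulAut B` is finite. The kernel of this action on
`M ⊓ G` lies in `B` by maximality of the hull. -/
theorem finite_torsionRadical_quotient_torsionHull (hΓ : HasFiniteAbelianSectionRank Γ)
    (A G : Subgroup Γ) [A.Normal] [hG : G.Normal] [Group.IsSolvable G] [G.FiniteIndex]
    [IsMulCommutative A] (hAG : A ≤ G) (hrad : torsionRadical Γ = ⊥) :
    Finite (torsionRadical (Γ ⧸ torsionHull A G)) := by
  set B := torsionHull A G with hB
  have : IsMulCommutative B := isMulCommutative_torsionHull hrad
  have : IsMulTorsionFree B := isMulTorsionFree_torsionHull hrad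
  have hAB : A ≤ B := self_le_torsionHull hAG
  let M : Subgroup Γ := (torsionRadical (Γ ⧸ B)).comap (QuotientGroup.mk' B)
  have hM : ∀ x ∈ M, ∃ k, 0 < k ∧ x ^ k ∈ B := fun x hx =>
    exists_pow_mem_of_mk_isOfFinOrder (isOfFinOrder_of_mem_torsionRadical hx)
  let ρ : Γ →* MulAut B := MulAut.conjNormal
  have hker : ∀ x, x ∈ ρ.ker ↔ x ∈ Subgroup.centralizer (B : Set Γ) := fun x => by
    rw [MonoidHom.mem_ker, Subgroup.mem_centralizer_iff]
    constructor
    · intro h b hb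
      have := congrArg Subtype.val (DFunLike.congr_fun h (⟨b, hb⟩ : B))
      exact (mul_inv_eq_iff_eq_mul.1 this).symm
    · intro h
      ext b
      exact mul_inv_eq_iff_eq_mul.2 (h b b.2).symm
  have hle : ρ.ker ⊓ (M ⊓ G) ≤ B := by
    have : (ρ.ker ⊓ (M ⊓ G)).Normal := inferInstance
    refine le_torsionHull (fun x hx => ?_) (inf_le_right.trans inf_le_right) fun x hx => ?_
    · exact Subgroup.centralizer_le hAB ((hker x).1 hx.1)
    · obtain ⟨k, hk, hxk⟩ := hM x hx.2.1
      obtain ⟨l, hl, hxl⟩ := exists_pow_mem_of_mem_torsionHull hxk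
      exact ⟨k * l, Nat.mul_pos hk hl, by rwa [pow_mul]⟩
  have hfin : Finite ((M ⊓ G).map ρ) := by
    have : Group.IsSolvable (M ⊓ G : Subgroup Γ) :=
      Group.isSolvable_of_isSolvable_injective (Subgroup.inclusion_injective inf_le_right)
    have : Group.IsSolvable ((M ⊓ G).map ρ) :=
      Group.isSolvable_of_surjective (ρ.subgroupMap_surjective (M ⊓ G))
    refine finite_of_torsion_isSolvable_mulAut (hΓ.hasFiniteRank B) _ ?_
    rintro _ ⟨x, hx, rfl⟩
    obtain ⟨k, hk, hxk⟩ := hM x hx.1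
    refine isOfFinOrder_iff_pow_eq_one.2 ⟨k, hk, ?_⟩
    rw [← map_pow]
    exact (hker _).2 (Subgroup.le_centralizer B hxk)
  have h1 : B.relIndex (M ⊓ G) ≠ 0 := by
    have h2 : ρ.ker.relIndex (M ⊓ G) ≠ 0 := by
      rw [Subgroup.relIndex_ker]
      exact Nat.card_pos.ne'
    rw [← Subgroup.inf_relIndex_right] at h2
    exact fun h => h2 (Subgroup.relIndex_eq_zero_of_le_left hle h)
  have h2 : (M ⊓ G).relIndex M ≠ 0 := by
    rw [inf_comm, Subgroup.inf_relIndex_right]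
    exact (Subgroup.isFiniteRelIndex_of_finiteIndex).relIndex_ne_zero
  have h3 := Subgroup.relIndex_ne_zero_trans h1 h2
  have h4 : B = (QuotientGroup.mk' B).ker := (QuotientGroup.ker_mk' B).symm
  have h5 : M.map (QuotientGroup.mk' B) = torsionRadical (Γ ⧸ B) :=
    Subgroup.map_comap_eq_self_of_surjective (QuotientGroup.mk'_surjective B) _
  rw [h4, Subgroup.relIndex_ker, h5] at h3
  exact Nat.finite_of_card_ne_zero h3

theorem derivedSeries_map_eq {Γ' : Type*} [Group Γ'] (f : Γ →* Γ') (G : Subgroup Γ) (n : ℕ) :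
    (derivedSeries (G.map f) n).map (G.map f).subtype =
      ((derivedSeries G n).map G.subtype).map f := by
  rw [← map_derivedSeries_eq (f.subgroupMap_surjective G), Subgroup.map_map, Subgroup.map_map]
  rfl

theorem derivedSeries_map_eq_bot_iff {Γ' : Type*} [Group Γ'] (f : Γ →* Γ') (G : Subgroup Γ)
    (n : ℕ) : derivedSeries (G.map f) n = ⊥ ↔ (derivedSeries G n).map G.subtype ≤ f.ker := by
  rw [← Subgroup.map_eq_bot_iff, ← derivedSeries_map_eq,
    Subgroup.map_eq_bot_iff_of_injective _ (Subgroup.subtype_injective _)]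

/-- The centralizer condition forces the join of two finite subgroups to be finite, by induction
on the derived length of a solvable normal subgroup of finite index. -/
theorem finite_sup_of_derivedSeries_eq_bot (d : ℕ) : ∀ {Γ : Type u} [Group Γ],
    HasFiniteAbelianSectionRank Γ → Finite (torsionRadical Γ) →
    ∀ (G : Subgroup Γ) [G.Normal] [G.FiniteIndex], derivedSeries G d = ⊥ →
    ∀ (H T L : Subgroup Γ), Finite T → Finite L → H ≤ T → H ≤ L →
    (Subgroup.centralizer (T : Set Γ)).IsFiniteRelIndex (Subgroup.centralizer (H : Set Γ)) →
    Finite (T ⊔ L : Subgroup Γ) := by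
  induction d with
  | zero =>
    intro Γ _ _ _ G _ hGi hG H T L _ _ _ _ _
    rw [derivedSeries_zero, ← Subgroup.card_eq_one, Subgroup.card_top, Subgroup.card_eq_one] at hG
    have h := hGi.index_ne_zero
    rw [hG, Subgroup.index_bot] at h
    have := Nat.finite_of_card_ne_zero h
    infer_instance
  | succ d ih =>
    -- The case of trivial radical, where dividing by `B ≥ A` lowers the derived length. Dividing by
    -- the radical does not lower it, so `key` is stated for `d + 1`.
    have key : ∀ {Γ : Type u} [Group Γ], HasFiniteAbelianSectionRank Γ → torsionRadical Γ = ⊥ →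
        ∀ (G : Subgroup Γ) [G.Normal] [G.FiniteIndex], derivedSeries G (d + 1) = ⊥ →
        ∀ (H T L : Subgroup Γ), Finite T → Finite L → H ≤ T → H ≤ L →
        (Subgroup.centralizer (T : Set Γ)).IsFiniteRelIndex (Subgroup.centralizer (H : Set Γ)) →
        Finite (T ⊔ L : Subgroup Γ) := by
      intro Γ _ hΓ hrad G _ hGi hG H T L _ _ hHT hHL hindex
      have : Group.IsSolvable G := ⟨⟨_, hG⟩⟩
      let A : Subgroup Γ := (derivedSeries G d).map G.subtype
      have hAn : A.Normal := inferInstance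
      have hAG : A ≤ G := Subgroup.map_subtype_le _
      have hAc : IsMulCommutative A := by
        refine ⟨⟨?_⟩⟩
        rintro ⟨_, x, hx, rfl⟩ ⟨_, y, hy, rfl⟩
        have hxy := Subgroup.commutator_mem_commutator hx hy
        rw [← derivedSeries_succ, hG, Subgroup.mem_bot,
          commutatorElement_eq_one_iff_mul_comm] at hxy
        exact Subtype.ext (congrArg G.subtype hxy)
      have hAB := self_le_torsionHull hAG
      have hBfin := finite_torsionRadical_quotient_torsionHull hΓ A G hAG hrad
      set B := torsionHull A G with hB
      set f := QuotientGroup.mk' B with hf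
      have hker : f.ker = B := QuotientGroup.ker_mk' B
      have hsurj : Function.Surjective f := QuotientGroup.mk'_surjective B
      have hBc : IsMulCommutative f.ker := by
        rw [hker]; exact isMulCommutative_torsionHull hrad
      have hBt : IsMulTorsionFree f.ker := by
        rw [hker]; exact isMulTorsionFree_torsionHull hrad
      have : Finite H := Finite.of_injective _ (Subgroup.inclusion_injective hHT)
      have h1 := isFiniteRelIndex_centralizer_map f hsurj
        (relIndex_centralizer_sup_ker_of_torsionFree f
          (fun m hm => finiteIndex_range_powMonoidHom (hΓ.hasFiniteRank _) hm) H) hindex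
      have hGn : (G.map f).Normal := Subgroup.Normal.map inferInstance f hsurj
      have hGfi : (G.map f).FiniteIndex :=
        ⟨fun h => hGi.index_ne_zero (Nat.eq_zero_of_zero_dvd (h ▸ G.index_map_dvd hsurj))⟩
      have h2 : Finite (T.map f ⊔ L.map f : Subgroup (Γ ⧸ B)) :=
        ih (hΓ.of_surjective f hsurj) hBfin (G.map f)
          ((derivedSeries_map_eq_bot_iff f G d).2 (hker.symm ▸ hAB)) (H.map f) (T.map f) (L.map f)
          (finite_subgroup_map _ _) (finite_subgroup_map _ _) (Subgroup.map_mono hHT)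
          (Subgroup.map_mono hHL) h1
      rw [← Subgroup.map_sup] at h2
      exact finite_sup_of_finite_map_of_torsionFree f hHT hHL hindex
    -- The general case: divide by the finite radical and lift through the finite kernel.
    intro Γ _ hΓ hrad G _ hGi hG H T L _ _ hHT hHL hindex
    set f := QuotientGroup.mk' (torsionRadical Γ) with hf
    have hker : f.ker = torsionRadical Γ := QuotientGroup.ker_mk' _
    have hsurj : Function.Surjective f := QuotientGroup.mk'_surjective _
    have hkf : Finite f.ker := by rwa [hker]
    have : Finite H := Finite.of_injective _ (Subgroup.inclusion_injective hHT)
    have h1 := isFiniteRelIndex_centralizer_map f hsurj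
      (relIndex_centralizer_sup_ker_of_finite_ker f H) hindex
    have hGn : (G.map f).Normal := Subgroup.Normal.map inferInstance f hsurj
    have hGfi : (G.map f).FiniteIndex :=
      ⟨fun h => hGi.index_ne_zero (Nat.eq_zero_of_zero_dvd (h ▸ G.index_map_dvd hsurj))⟩
    have h2 : Finite (T.map f ⊔ L.map f : Subgroup (Γ ⧸ torsionRadical Γ)) :=
      key (hΓ.of_surjective f hsurj) torsionRadical_quotient_eq_bot (G.map f)
        ((derivedSeries_map_eq_bot_iff f G _).2 (by rw [hG, Subgroup.map_bot]; exact bot_le))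
        (H.map f) (T.map f) (L.map f)
        (finite_subgroup_map _ _) (finite_subgroup_map _ _) (Subgroup.map_mono hHT)
        (Subgroup.map_mono hHL) h1
    rw [← Subgroup.map_sup] at h2
    exact finite_of_finite_map_of_finite_ker f _

theorem finite_sup_of_isFiniteRelIndex_centralizer (hΓ : IsVirtuallyTorsionFreeSolvable Γ)
    (hrank : HasFiniteHirschRank Γ) {H T L : Subgroup Γ} [Finite T] [Finite L] (hHT : H ≤ T)
    (hHL : H ≤ L) (hindex : (Subgroup.centralizer (T : Set Γ)).IsFiniteRelIndex
      (Subgroup.centralizer (H : Set Γ))) : Finite (T ⊔ L : Subgroup Γ) := by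
  obtain ⟨G, hGi, hGs, hGt⟩ := hΓ
  have : Group.IsSolvable G.normalCore :=
    Group.isSolvable_of_isSolvable_injective (Subgroup.inclusion_injective G.normalCore_le)
  obtain ⟨d, hd⟩ := this
  exact finite_sup_of_derivedSeries_eq_bot d hrank.hasFiniteAbelianSectionRank
    (finite_torsionRadical_of_finiteIndex G hGt) G.normalCore hd H T L inferInstance inferInstance
    hHT hHL hindex

end Main

theorem mainTheorem8 {Γ : Type u} [Group Γ]
    (hΓ : IsVirtuallyTorsionFreeSolvable Γ) (hrank : HasFiniteHirschRank Γ)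
    (H : Subgroup Γ) (hH : Finite H)
    (T : Subgroup Γ) (hHT : H < T) (hT : Finite T)
    (hindex : (Subgroup.centralizer (T : Set Γ)).IsFiniteRelIndex
      (Subgroup.centralizer (H : Set Γ))) :
    (∀ L : Subgroup Γ, H < L → Finite L → Finite (T ⊔ L : Subgroup Γ)) ∧
      ContractibleSpace (posetRealization (FiniteSubgroupsAbove H)) := by
  have hfin : ∀ L : Subgroup Γ, H < L → Finite L → Finite (T ⊔ L : Subgroup Γ) := fun L hHL _ =>
    finite_sup_of_isFiniteRelIndex_centralizer hΓ hrank hHT.le hHL.le hindex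
  refine ⟨hfin, contractibleSpace_posetRealization
    (⟨fun K => ⟨T ⊔ K, hHT.trans_le le_sup_left, hfin K K.2.1 K.2.2⟩, fun K L hKL =>
      sup_le_sup_left (α := Subgroup Γ) hKL T⟩) ⟨T, hHT, hT⟩ (fun K => ?_) fun K => ?_⟩
  · exact (le_sup_right : (K : Subgroup Γ) ≤ T ⊔ K)
  · exact (le_sup_left : T ≤ T ⊔ (K : Subgroup Γ))
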